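/- Let $\Omega\subset\mathbb{R}^d$ be open. For $s\in\mathbb{R}$ and $p>1$ let $B^s_p=B^s_{p,p}(\Omega)$ be the Besov space of (real- or complex-valued) distributions on $\Omega$ that are restrictions of elements of $B^s_{p,p}(\mathbb{R}^d)$, and let $\mathcal{B}_D=B^{s_D}_{p_D}$ and $\mathcal{B}_R=B^{s_R}_{p_R}$ with $s_D,s_R\in\mathbb{R}$, $p_D>1$, $p_R>1$, be such that $\mathcal{B}_R\subset\mathcal{B}_D$ with continuous embedding. Let $(\psi_\lambda)_{\lambda\in\Lambda}$ be a wavelet basis for $\mathcal{B}_R$, that is, a Riesz basis of $L_2(\Omega)$ with scales $|\lambda|\in\mathbb{N}_0$ such that, with the wavelet coefficients $u_\lambda=\langle u,\psi_\lambda\rangle$ (the continuous extension of $\int_\Omega u\,\psi_\lambda\,dx$ to $u\in\mathcal{B}_R$), the expression $$\|u\|_{\mathcal{B}_R}:=\Big(\sum_{\lambda\in\Lambda}2^{p_R\left(s_R+d\left(\frac12-\frac1{p_R}\right)\right)|\lambda|}\,|u_\lambda|^{p_R}\Big)^{1/p_R}$$ is equivalent to the usual norm of $B^{s_R}_{p_R}$.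 Equip $\mathcal{B}_R$ with this norm, and put $\|u\|_{\mathcal{B}_R}=\infty$ for $u\in\mathcal{B}_D\setminus\mathcal{B}_R$. Let $F:\mathcal{B}_D\to L_2(\Omega)$ be linear and continuous, let $v\in L_2(\Omega)$, and let $u^\dagger\in\mathcal{B}_R$ be a minimum-$\|\cdot\|_{\mathcal{B}_R}$ solution of $Fu=v$, i.e. $Fu^\dagger=v$, $\|u^\dagger\|_{\mathcal{B}_R}<\infty$, and $\|u^\dagger\|_{\mathcal{B}_R}\le\|w\|_{\mathcal{B}_R}$ for every $w\in\mathcal{B}_D$ with $Fw=v$. For noise levels $\delta>0$ let $v^\delta\in L_2(\Omega)$ satisfy $\|v-v^\delta\|_{L_2}\le\delta$, let the regularization parameters satisfy $c\,\delta\le\alpha\le C\,\delta$ with constants $c,C>0$ independent of $\delta$, and let $u^{\alpha,\delta}\in\mathcal{B}_D$ be any minimizer over $\mathcal{B}_D$ of $$T_\alpha(u)=\|Fu-v^\delta\|_{L_2}^2+\alpha\|u\|_{\mathcal{B}_R}^{p_R}.$$ Then $\|u^{\alpha,\delta}-u^\dagger\|_{\mathcal{B}_R}\to0$ as $\delta\to0$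 (along every sequence, and more generally every net or filter, of noise levels tending to $0$ from above). -/

import Mathlib

open MeasureTheory Filter Topology TopologicalSpace
open scoped ENNReal NNReal SchwartzMap Distributions ContDiff

noncomputable section

namespace BesovTikhonov

/-- The Euclidean space `ℝᵈ`. -/
abbrev Space (d : ℕ) : Type := EuclideanSpace ℝ (Fin d)

/-! ### Littlewood–Paley decomposition and Besov spaces on `ℝᵈ` -/

/-- A smooth cut-off function on `ℝᵈ`, equal to `1` on the ball of radius `1` and vanishing outside
the ball of radius `2`. -/
def cutoff (d : ℕ) : ContDiffBump (0 : Space d) where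
  rIn := 1
  rOut := 2
  rIn_pos := one_pos
  rIn_lt_rOut := one_lt_two

/-- The smooth dyadic resolution of unity `χ₀ = χ`, `χⱼ(ξ) = χ(2⁻ʲ ξ) - χ(2¹⁻ʲ ξ)` for `j ≥ 1`. -/
def dyadicSymbol (d : ℕ) : ℕ → Space d → ℝ
  | 0 => fun ξ => cutoff d ξ
  | j + 1 => fun ξ => cutoff d ((2⁻¹ : ℝ) ^ (j + 1) • ξ) - cutoff d ((2⁻¹ : ℝ) ^ j • ξ)

theorem contDiff_cutoff_smul (d : ℕ) (c : ℝ) :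
    ContDiff ℝ ∞ (fun ξ : Space d => cutoff d (c • ξ)) :=
  (cutoff d).contDiff.comp (contDiff_const_smul c)

theorem hasCompactSupport_cutoff_smul (d : ℕ) {c : ℝ} (hc : c ≠ 0) :
    HasCompactSupport (fun ξ : Space d => cutoff d (c • ξ)) :=
  (cutoff d).hasCompactSupport.comp_smul hc

/-- The symbols have temperate growth, so that the Fourier multipliers below are the genuine ones
(and not the default value that Mathlib assigns to other symbols). -/
theorem hasTemperateGrowth_dyadicSymbol (d j : ℕ) :
    (fun ξ : Space d => (dyadicSymbol d j ξ : ℂ)).HasTemperateGrowth := by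
  have key : (dyadicSymbol d j).HasTemperateGrowth := by
    cases j with
    | zero =>
      exact (cutoff d).hasCompactSupport.hasTemperateGrowth (cutoff d).contDiff
    | succ j =>
      exact ((hasCompactSupport_cutoff_smul d (by positivity)).hasTemperateGrowth
          (contDiff_cutoff_smul d _)).sub
        ((hasCompactSupport_cutoff_smul d (by positivity)).hasTemperateGrowth
          (contDiff_cutoff_smul d _))
  exact Function.Complex.hasTemperateGrowth_ofReal.comp key

/-- The Littlewood–Paley block `Δⱼ U = 𝓕⁻¹ (χⱼ 𝓕 U)` of a tempered distribution. -/
def lpBlock {d : ℕ} (j : ℕ) (U : 𝓢'(Space d, ℂ)) : 𝓢'(Space d, ℂ) :=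
  TemperedDistribution.fourierMultiplierCLM ℂ (fun ξ => (dyadicSymbol d j ξ : ℂ)) U

/-- `g` is an `Lᵖ` function representing the tempered distribution `T`. -/
def IsLpDensity {d : ℕ} (p : ℝ≥0∞) (T : 𝓢'(Space d, ℂ)) (g : Space d → ℂ) : Prop :=
  MemLp g p volume ∧ ∀ φ : 𝓢(Space d, ℂ), T φ = ∫ x, φ x * g x

/-- The `Lᵖ` norm of a tempered distribution: `‖g‖_{Lᵖ}` if it is represented by `g ∈ Lᵖ` (which is
then unique almost everywhere), and `∞` if there is no such `g`. -/
def distLpNorm {d : ℕ} (p : ℝ≥0∞) (T : 𝓢'(Space d, ℂ)) : ℝ≥0∞ :=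
  ⨅ (g : Space d → ℂ) (_ : IsLpDensity p T g), eLpNorm g p volume

/-- The Besov norm of `B^s_{p,p}(ℝᵈ)`, with values in `[0, ∞]`:
`‖U‖ = (∑ⱼ (2^{js} ‖Δⱼ U‖_{Lᵖ})ᵖ)^{1/p}`. -/
def besovNormWhole {d : ℕ} (s p : ℝ) (U : 𝓢'(Space d, ℂ)) : ℝ≥0∞ :=
  (∑' j : ℕ, (ENNReal.ofReal ((2 : ℝ) ^ ((j : ℝ) * s)) *
    distLpNorm (ENNReal.ofReal p) (lpBlock j U)) ^ p) ^ (1 / p)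

theorem distLpNorm_add_le {d : ℕ} {p : ℝ≥0∞} (hp : 1 ≤ p) (S T : 𝓢'(Space d, ℂ)) :
    distLpNorm p (S + T) ≤ distLpNorm p S + distLpNorm p T := by
  have hint : ∀ {R : 𝓢'(Space d, ℂ)} {g : Space d → ℂ}, IsLpDensity p R g →
      ∀ φ : 𝓢(Space d, ℂ), Integrable (fun x => φ x * g x) := by
    intro R g hg φ
    have := ENNReal.HolderConjugate.inv_one_sub_inv' hp
    exact MemLp.integrable_mul (φ.memLp ((1 - p⁻¹)⁻¹)) hg.1
  unfold distLpNorm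
  simp only [ENNReal.iInf_add, ENNReal.add_iInf]
  refine le_iInf₂ fun h hh => le_iInf₂ fun g hg => ?_
  refine iInf₂_le_of_le (g + h) ⟨hg.1.add hh.1, fun φ => ?_⟩
    (eLpNorm_add_le hg.1.1 hh.1.1 hp)
  have h1 : (S + T) φ = S φ + T φ := rfl
  rw [h1, hg.2 φ, hh.2 φ, ← integral_add (hint hg φ) (hint hh φ)]
  simp [mul_add]

theorem distLpNorm_zero {d : ℕ} (p : ℝ≥0∞) : distLpNorm p (0 : 𝓢'(Space d, ℂ)) = 0 := by
  refine le_antisymm (iInf₂_le_of_le 0 ⟨MemLp.zero, ?_⟩ (by simp)) bot_le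
  intro φ
  have h1 : (0 : 𝓢'(Space d, ℂ)) φ = 0 := rfl
  simp [h1]

theorem distLpNorm_smul_le {d : ℕ} (p : ℝ≥0∞) (c : ℂ) (T : 𝓢'(Space d, ℂ)) :
    distLpNorm p (c • T) ≤ ‖c‖ₑ * distLpNorm p T := by
  have step : ∀ g, IsLpDensity p T g → distLpNorm p (c • T) ≤ ‖c‖ₑ * eLpNorm g p volume := by
    intro g hg
    refine iInf₂_le_of_le (c • g) ⟨hg.1.const_smul c, fun φ => ?_⟩ eLpNorm_const_smul_le
    have h1 : (c • T) φ = c * T φ := rfl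
    rw [h1, hg.2 φ, ← integral_const_mul]
    simp [mul_left_comm]
  rcases eq_or_ne c 0 with rfl | hc
  · have h0 : (0 : ℂ) • T = 0 := zero_smul ℂ T
    rw [h0, distLpNorm_zero]
    exact bot_le
  · conv_rhs => unfold distLpNorm
    rw [ENNReal.mul_iInf_of_ne (by simpa using hc) (by finiteness)]
    refine le_iInf fun g => ?_
    rw [ENNReal.mul_iInf_of_ne (by simpa using hc) (by finiteness)]
    exact le_iInf fun hg => step g hg

theorem besovNormWhole_lt_top_iff {d : ℕ} {s p : ℝ} (hp : 1 ≤ p) (U : 𝓢'(Space d, ℂ)) :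
    besovNormWhole s p U < ⊤ ↔ ∑' j : ℕ, (ENNReal.ofReal ((2 : ℝ) ^ ((j : ℝ) * s)) *
      distLpNorm (ENNReal.ofReal p) (lpBlock j U)) ^ p < ⊤ := by
  unfold besovNormWhole
  exact ENNReal.rpow_lt_top_iff_of_pos (by positivity)

theorem besovNormWhole_add_lt_top {d : ℕ} {s p : ℝ} (hp : 1 ≤ p) {U V : 𝓢'(Space d, ℂ)}
    (hU : besovNormWhole s p U < ⊤) (hV : besovNormWhole s p V < ⊤) :
    besovNormWhole s p (U + V) < ⊤ := by
  rw [besovNormWhole_lt_top_iff hp] at *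
  have hp' : 1 ≤ ENNReal.ofReal p := by simpa using ENNReal.ofReal_le_ofReal hp
  refine lt_of_le_of_lt (b := 2 ^ (p - 1) * (_ + _)) ?_
    (ENNReal.mul_lt_top (by finiteness) (ENNReal.add_lt_top.2 ⟨hU, hV⟩))
  rw [← ENNReal.tsum_add, ← ENNReal.tsum_mul_left]
  refine ENNReal.tsum_le_tsum fun j => ?_
  refine le_trans ?_ (ENNReal.rpow_add_le_mul_rpow_add_rpow _ _ hp)
  rw [← mul_add]
  gcongr
  have : lpBlock j (U + V) = lpBlock j U + lpBlock j V := map_add _ _ _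
  rw [this]
  exact distLpNorm_add_le hp' _ _

theorem besovNormWhole_smul_lt_top {d : ℕ} {s p : ℝ} (hp : 1 ≤ p) (c : ℂ) {U : 𝓢'(Space d, ℂ)}
    (hU : besovNormWhole s p U < ⊤) : besovNormWhole s p (c • U) < ⊤ := by
  have hp0 : 0 ≤ p := by linarith
  rw [besovNormWhole_lt_top_iff hp] at *
  refine lt_of_le_of_lt (b := ‖c‖ₑ ^ p * _) ?_ (ENNReal.mul_lt_top (by finiteness) hU)
  rw [← ENNReal.tsum_mul_left]
  refine ENNReal.tsum_le_tsum fun j => ?_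
  rw [← ENNReal.mul_rpow_of_nonneg _ _ hp0, mul_left_comm]
  gcongr
  have : lpBlock j (c • U) = c • lpBlock j U := map_smul _ _ _
  rw [this]
  exact distLpNorm_smul_le _ _ _

theorem besovNormWhole_zero {d : ℕ} {s p : ℝ} (hp : 1 ≤ p) :
    besovNormWhole s p (0 : 𝓢'(Space d, ℂ)) < ⊤ := by
  have h0 : ∀ j, distLpNorm (ENNReal.ofReal p) (lpBlock j (0 : 𝓢'(Space d, ℂ))) = 0 := by
    intro j
    have : lpBlock j (0 : 𝓢'(Space d, ℂ)) = 0 := map_zero _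
    rw [this]
    exact distLpNorm_zero _
  rw [besovNormWhole_lt_top_iff hp]
  simp [h0, ENNReal.zero_rpow_of_pos (by linarith : 0 < p)]

/-! ### Besov spaces on an open set `Ω ⊆ ℝᵈ` (real or complex valued) -/

section Domain

variable {𝕜 : Type*} [RCLike 𝕜] {d : ℕ} {Ω : Opens (Space d)}

/-- A real test function on `Ω`, extended by zero and viewed as a complex Schwartz function. -/
def testToSchwartz (φ : 𝓓(Ω, ℝ)) : 𝓢(Space d, ℂ) :=
  HasCompactSupport.toSchwartzMap (f := fun x => ((φ x : ℝ) : ℂ))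
    (φ.hasCompactSupport.comp_left (g := fun t : ℝ => (t : ℂ)) Complex.ofReal_zero)
    (Complex.ofRealCLM.contDiff.comp φ.contDiff)

/-- `T` is the restriction to `Ω` of the tempered distribution `U`. -/
def IsRestriction (U : 𝓢'(Space d, ℂ)) (T : 𝓓'(Ω, 𝕜)) : Prop :=
  ∀ φ : 𝓓(Ω, ℝ), RCLike.map 𝕜 ℂ (T φ) = U (testToSchwartz φ)

/-- The norm of `B^s_p(Ω) = B^s_{p,p}(Ω)`, with values in `[0, ∞]`: the infimum of the norms of all
extensions to `ℝᵈ`. -/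
def besovNorm (s p : ℝ) (T : 𝓓'(Ω, 𝕜)) : ℝ≥0∞ :=
  ⨅ (U : 𝓢'(Space d, ℂ)) (_ : IsRestriction U T), besovNormWhole s p U

theorem besovNorm_lt_top_iff (s p : ℝ) (T : 𝓓'(Ω, 𝕜)) :
    besovNorm s p T < ⊤ ↔
      ∃ U : 𝓢'(Space d, ℂ), IsRestriction U T ∧ besovNormWhole s p U < ⊤ := by
  simp only [besovNorm, iInf_lt_iff, exists_prop]

theorem map_mul' (a b : 𝕜) : RCLike.map 𝕜 ℂ (a * b) = RCLike.map 𝕜 ℂ a * RCLike.map 𝕜 ℂ b := by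
  apply Complex.ext <;> simp [RCLike.map_apply]

variable (𝕜 Ω) in
/-- The Besov space `B^s_p(Ω) = B^s_{p,p}(Ω)` of `𝕜`-valued distributions on `Ω`: the restrictions
to `Ω` of the elements of `B^s_{p,p}(ℝᵈ)`. -/
def besovSpace (s p : ℝ) (hp : 1 ≤ p) : Submodule 𝕜 𝓓'(Ω, 𝕜) where
  carrier := {T | besovNorm s p T < ⊤}
  zero_mem' := (besovNorm_lt_top_iff s p _).2 ⟨0, fun φ => by simp, besovNormWhole_zero hp⟩
  add_mem' {S T} hS hT := by
    obtain ⟨U, hU, hU'⟩ := (besovNorm_lt_top_iff s p _).1 hS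
    obtain ⟨V, hV, hV'⟩ := (besovNorm_lt_top_iff s p _).1 hT
    refine (besovNorm_lt_top_iff s p _).2
      ⟨U + V, fun φ => ?_, besovNormWhole_add_lt_top hp hU' hV'⟩
    change RCLike.map 𝕜 ℂ (S φ + T φ) = U (testToSchwartz φ) + V (testToSchwartz φ)
    rw [map_add, hU φ, hV φ]
  smul_mem' c T hT := by
    obtain ⟨U, hU, hU'⟩ := (besovNorm_lt_top_iff s p _).1 hT
    refine (besovNorm_lt_top_iff s p _).2
      ⟨RCLike.map 𝕜 ℂ c • U, fun φ => ?_, besovNormWhole_smul_lt_top hp _ hU'⟩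
    change RCLike.map 𝕜 ℂ (c * T φ) = RCLike.map 𝕜 ℂ c * U (testToSchwartz φ)
    rw [map_mul', hU φ]

variable (𝕜 Ω) in
/-- The embedding `B^{s₁}_{p₁}(Ω) ⊂ B^{s₂}_{p₂}(Ω)`: set-theoretic and continuous. (For
`T ∈ B^{s₁}_{p₁}(Ω)` the right-hand side is finite, so `T ∈ B^{s₂}_{p₂}(Ω)` is part of it.) -/
def BesovEmbeds (s₁ p₁ s₂ p₂ : ℝ) : Prop :=
  ∃ C : ℝ≥0, ∀ T : 𝓓'(Ω, 𝕜), besovNorm s₁ p₁ T < ⊤ → besovNorm s₂ p₂ T ≤ C * besovNorm s₁ p₁ T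

/-! ### Wavelet bases and the wavelet norm -/

variable (𝕜 Ω) in
/-- The Lebesgue space `L₂(Ω)`. -/
abbrev L2 : Type _ := Lp 𝕜 2 (volume.restrict (Ω : Set (Space d)))

/-- `ψ` is a Riesz basis of `L₂(Ω)`; every orthonormal basis is one. -/
def IsRieszBasis {Λ : Type*} (ψ : Λ → L2 𝕜 Ω) : Prop :=
  (Submodule.span 𝕜 (Set.range ψ)).topologicalClosure = ⊤ ∧
  ∃ c C : ℝ, 0 < c ∧ 0 < C ∧ ∀ a : Λ →₀ 𝕜,
    c * (a.sum fun _ z => ‖z‖ ^ 2) ≤ ‖a.sum fun l z => z • ψ l‖ ^ 2 ∧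
    ‖a.sum fun l z => z • ψ l‖ ^ 2 ≤ C * (a.sum fun _ z => ‖z‖ ^ 2)

variable (𝕜 Ω) in
/-- A wavelet basis `(ψ_λ)_{λ ∈ Λ}` for the Besov space `B^s_p(Ω)`: a Riesz basis of `L₂(Ω)`
(not necessarily orthonormal), with scales `|λ| ∈ ℕ`, whose wavelet coefficients
`u_λ = ⟨u, ψ_λ⟩ = ∫ u ψ_λ dx` describe the Besov norm,
`‖u‖_{B^s_p}^p ≍ ∑_λ 2^{p (s + d (1/2 - 1/p)) |λ|} |u_λ|^p`.

A general `u ∈ B^s_p(Ω)` is a distribution and `ψ_λ` need not be a test function, so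
`⟨u, ψ_λ⟩` is the duality pairing, that is the extension by continuity of the integral: `coeff l` is
a linear functional, by `norm_equiv` it is continuous on `B^s_p(Ω)`, and by `coeff_eq_integral` it
is the integral against `ψ_λ` on the restrictions to `Ω` of Schwartz functions, which are dense. -/
structure BesovWaveletBasis (s p : ℝ) (hp : 1 ≤ p) (Λ : Type*) where
  /-- the scale `|λ|` -/
  scale : Λ → ℕ
  /-- the wavelets `ψ_λ` -/
  ψ : Λ → L2 𝕜 Ω
  isRieszBasis : IsRieszBasis ψ
  /-- the coefficients `u_λ = ⟨u, ψ_λ⟩` -/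
  coeff : Λ → besovSpace 𝕜 Ω s p hp →ₗ[𝕜] 𝕜
  coeff_eq_integral : ∀ (l : Λ) (u : besovSpace 𝕜 Ω s p hp) (f : 𝓢(Space d, 𝕜)),
    (∀ φ : 𝓓(Ω, ℝ), (u : 𝓓'(Ω, 𝕜)) φ = ∫ x, φ x • f x) →
      coeff l u = ∫ x in (Ω : Set (Space d)), f x * ψ l x
  norm_equiv : ∃ c C : ℝ≥0, 0 < c ∧ 0 < C ∧ ∀ u : besovSpace 𝕜 Ω s p hp,
    let E : ℝ≥0∞ := ∑' l : Λ, ENNReal.ofReal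
      ((2 : ℝ) ^ (p * (s + d * (1 / 2 - 1 / p)) * (scale l : ℝ))) * ‖coeff l u‖ₑ ^ p
    c * besovNorm s p (u : 𝓓'(Ω, 𝕜)) ^ p ≤ E ∧ E ≤ C * besovNorm s p (u : 𝓓'(Ω, 𝕜)) ^ p

open Classical in
/-- The wavelet norm `‖T‖_{B^s_p} = (∑_λ 2^{p (s + d (1/2 - 1/p)) |λ|} |T_λ|^p)^{1/p}`, set to `∞`
for a distribution `T` outside `B^s_p(Ω)`. -/
def BesovWaveletBasis.norm {s p : ℝ} {hp : 1 ≤ p} {Λ : Type*}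
    (W : BesovWaveletBasis 𝕜 Ω s p hp Λ) (T : 𝓓'(Ω, 𝕜)) : ℝ≥0∞ :=
  if hT : T ∈ besovSpace 𝕜 Ω s p hp then
    (∑' l : Λ, ENNReal.ofReal
      ((2 : ℝ) ^ (p * (s + d * (1 / 2 - 1 / p)) * (W.scale l : ℝ))) *
        ‖W.coeff l ⟨T, hT⟩‖ₑ ^ p) ^ (1 / p)
  else ⊤

/-! ### Tikhonov regularization -/

/-- The linear operator `F : B^s_p(Ω) → L₂(Ω)` is continuous, i.e. bounded. -/
def IsBoundedOp {s p : ℝ} {hp : 1 ≤ p} (F : besovSpace 𝕜 Ω s p hp →ₗ[𝕜] L2 𝕜 Ω) : Prop :=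
  ∃ C : ℝ≥0, ∀ u : besovSpace 𝕜 Ω s p hp, ‖F u‖ₑ ≤ C * besovNorm s p (u : 𝓓'(Ω, 𝕜))

variable {sD pD sR pR : ℝ} {hpD : 1 ≤ pD} {hpR : 1 ≤ pR} {Λ : Type*}

/-- The Tikhonov functional `T_α(u) = ‖F u - w‖² + α ‖u‖_{B_R}^{p_R}` on `B_D`, with values in
`[0, ∞]`, for the data `w`. -/
def tikhonov (W : BesovWaveletBasis 𝕜 Ω sR pR hpR Λ)
    (F : besovSpace 𝕜 Ω sD pD hpD →ₗ[𝕜] L2 𝕜 Ω) (w : L2 𝕜 Ω) (α : ℝ)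
    (u : besovSpace 𝕜 Ω sD pD hpD) : ℝ≥0∞ :=
  ‖F u - w‖ₑ ^ 2 + ENNReal.ofReal α * W.norm (u : 𝓓'(Ω, 𝕜)) ^ pR

/-- `u` is a minimum-`‖·‖_{B_R}` solution of `F u = v`: it is a solution of finite `B_R`-norm, and no
solution in `B_D` has a smaller `B_R`-norm. -/
def IsMinNormSolution (W : BesovWaveletBasis 𝕜 Ω sR pR hpR Λ)
    (F : besovSpace 𝕜 Ω sD pD hpD →ₗ[𝕜] L2 𝕜 Ω) (v : L2 𝕜 Ω)
    (u : besovSpace 𝕜 Ω sD pD hpD) : Prop :=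
  F u = v ∧ W.norm (u : 𝓓'(Ω, 𝕜)) < ⊤ ∧
    ∀ w : besovSpace 𝕜 Ω sD pD hpD, F w = v → W.norm (u : 𝓓'(Ω, 𝕜)) ≤ W.norm (w : 𝓓'(Ω, 𝕜))

end Domain

end BesovTikhonov

end

open BesovTikhonov

/-!
The weighted wavelet coefficients identify `B_R` isometrically with a subspace of `ℓᵖ`, `1 < p < ∞`,
so `B_R` is uniformly convex. It is also complete: splitting a test function by high-pass filters
shows that `|U φ|` is at most the Besov norm of `U` times a Schwartz seminorm of `φ`, so a series
that converges absolutely in the Besov norm converges as a distribution.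

In a complete uniformly convex space, a decreasing sequence of nonempty bounded closed convex sets
has a common point. Hence `‖F w - F u†‖ → 0` forces `lim inf ‖w‖ ≥ ‖u†‖` for a minimum-norm solution
`u†`. The Tikhonov inequality gives `F u^{α,δ} → F u†` and `lim sup ‖u^{α,δ}‖ ≤ ‖u†‖`. The midpoints
of `u^{α,δ}` and `u†` then have asymptotically the norm `‖u†‖` as well, and uniform convexity makes
the two points approach each other.
-/

noncomputable section

namespace BesovTikhonov

/-! ### Uniform convexity of `ℓᵖ` -/

section UniformConvexity

variable {E : Type*} [SeminormedAddCommGroup E] [NormedSpace ℝ E] {p ε : ℝ}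

theorem norm_midpoint_le (a b : E) : ‖(1 / 2 : ℝ) • (a + b)‖ ≤ (‖a‖ + ‖b‖) / 2 := by
  have := norm_add_le a b
  rw [norm_smul, Real.norm_of_nonneg one_half_pos.le]
  linarith

theorem norm_midpoint_rpow_le (hp : 1 ≤ p) (a b : E) :
    ‖(1 / 2 : ℝ) • (a + b)‖ ^ p ≤ (‖a‖ ^ p + ‖b‖ ^ p) / 2 := by
  have hconv := (convexOn_rpow hp).2 (norm_nonneg a) (norm_nonneg b)
    one_half_pos.le one_half_pos.le (add_halves 1)
  simp only [smul_eq_mul, ← mul_add] at hconv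
  calc ‖(1 / 2 : ℝ) • (a + b)‖ ^ p ≤ (1 / 2 * (‖a‖ + ‖b‖)) ^ p := by
        gcongr
        linarith [norm_midpoint_le a b]
    _ ≤ (‖a‖ ^ p + ‖b‖ ^ p) / 2 := by linarith

variable (E) [UniformConvexSpace E]

theorem exists_norm_midpoint_le_of_le_norm_sub (hε : 0 < ε) :
    ∃ r, 0 ≤ r ∧ r < 1 ∧ ∀ ⦃a b : E⦄, ‖a‖ ≤ 1 → ‖b‖ ≤ 1 → ε ≤ ‖a - b‖ →
      ‖(1 / 2 : ℝ) • (a + b)‖ ≤ r := by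
  obtain ⟨δ, hδ, hball⟩ := exists_forall_closed_ball_dist_add_le_two_sub E hε
  refine ⟨max 0 (1 - δ / 2), le_max_left _ _, max_lt one_pos (by linarith), fun a b ha hb hab => ?_⟩
  refine le_max_of_le_right ?_
  have := hball ha hb hab
  rw [norm_smul, Real.norm_of_nonneg one_half_pos.le]
  linarith

theorem exists_norm_midpoint_rpow_add_le (hp : 1 < p) (hε : 0 < ε) :
    ∃ m > 0, ∀ ⦃a b : E⦄, ‖a‖ = 1 → ‖b‖ ≤ 1 → ε ≤ ‖a - b‖ →
      ‖(1 / 2 : ℝ) • (a + b)‖ ^ p + m ≤ (‖a‖ ^ p + ‖b‖ ^ p) / 2 := by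
  have hp₀ : 0 < p := one_pos.trans hp
  obtain ⟨r, hr₀, hr₁, hr⟩ := exists_norm_midpoint_le_of_le_norm_sub E hε
  let gap : ℝ → ℝ := fun t => (1 + t ^ p) / 2 - min ((1 + t) / 2) r ^ p
  have hgap_cont : Continuous gap := by
    have := Real.continuous_rpow_const hp₀.le
    fun_prop
  have hgap_pos : ∀ t ∈ Set.Icc (0 : ℝ) 1, 0 < gap t := by
    rintro t ⟨ht₀, ht₁⟩
    have hmin : 0 ≤ min ((1 + t) / 2) r := le_min (by linarith) hr₀
    rcases ht₁.lt_or_eq with ht | rfl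
    · have hconv := (strictConvexOn_rpow hp).2 (Set.mem_Ici.2 zero_le_one) ht₀ ht.ne'
        one_half_pos one_half_pos (add_halves 1)
      simp only [smul_eq_mul, ← mul_add, Real.one_rpow] at hconv
      have := Real.rpow_le_rpow hmin (min_le_left _ _) hp₀.le
      rw [show (1 + t) / 2 = 1 / 2 * (1 + t) by ring] at this
      simp only [gap, show (1 + t) / 2 = 1 / 2 * (1 + t) by ring]
      linarith
    · have := Real.rpow_lt_one hmin ((min_le_right _ _).trans_lt hr₁) hp₀
      simp only [gap, Real.one_rpow]
      linarith
  obtain ⟨m, hm, hm_le⟩ := isCompact_Icc.exists_forall_le' hgap_cont.continuousOn hgap_pos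
  refine ⟨m, hm, fun a b ha hb hab => ?_⟩
  have hmid : ‖(1 / 2 : ℝ) • (a + b)‖ ^ p ≤ min ((1 + ‖b‖) / 2) r ^ p := by
    gcongr
    exact le_min (ha ▸ norm_midpoint_le a b) (hr ha.le hb hab)
  have := hm_le ‖b‖ ⟨norm_nonneg b, hb⟩
  simp only [gap] at this
  rw [ha, Real.one_rpow]
  linarith

theorem exists_norm_sub_rpow_le_of_norm_eq_one (hp : 1 < p) (hε : 0 < ε) :
    ∃ K > 0, ∀ ⦃a b : E⦄, ‖a‖ = 1 → ‖b‖ ≤ 1 → ‖a - b‖ ^ p ≤ ε * (‖a‖ ^ p + ‖b‖ ^ p) +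
      K * ((‖a‖ ^ p + ‖b‖ ^ p) / 2 - ‖(1 / 2 : ℝ) • (a + b)‖ ^ p) := by
  have hp₀ : 0 < p := one_pos.trans hp
  obtain ⟨m, hm, hgap⟩ :=
    exists_norm_midpoint_rpow_add_le E hp (Real.rpow_pos_of_pos hε p⁻¹)
  have hK : 0 < 2 ^ p / m := by positivity
  refine ⟨2 ^ p / m, hK, fun a b ha hb => ?_⟩
  rcases le_or_gt (ε ^ p⁻¹) ‖a - b‖ with hfar | hclose
  · calc ‖a - b‖ ^ p ≤ 2 ^ p := by
          gcongr
          linarith [norm_sub_le a b]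
      _ = 2 ^ p / m * m := by field_simp
      _ ≤ 2 ^ p / m * ((‖a‖ ^ p + ‖b‖ ^ p) / 2 - ‖(1 / 2 : ℝ) • (a + b)‖ ^ p) := by
          gcongr
          linarith [hgap ha hb hfar]
      _ ≤ _ := le_add_of_nonneg_left (by positivity)
  · have hsum : 1 ≤ ‖a‖ ^ p + ‖b‖ ^ p := by
      rw [ha, Real.one_rpow]
      linarith [Real.rpow_nonneg (norm_nonneg b) p]
    calc ‖a - b‖ ^ p ≤ (ε ^ p⁻¹) ^ p := by gcongr
      _ = ε := Real.rpow_inv_rpow hε.le hp₀.ne'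
      _ ≤ ε * (‖a‖ ^ p + ‖b‖ ^ p) := le_mul_of_one_le_right hε.le hsum
      _ ≤ _ := le_add_of_nonneg_right
          (mul_nonneg hK.le (sub_nonneg.2 (norm_midpoint_rpow_le hp.le a b)))

theorem exists_norm_sub_rpow_le (hp : 1 < p) (hε : 0 < ε) :
    ∃ K > 0, ∀ a b : E, ‖a - b‖ ^ p ≤ ε * (‖a‖ ^ p + ‖b‖ ^ p) +
      K * ((‖a‖ ^ p + ‖b‖ ^ p) / 2 - ‖(1 / 2 : ℝ) • (a + b)‖ ^ p) := by
  have hp₀ : 0 < p := one_pos.trans hp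
  obtain ⟨K, hK, hunit⟩ := exists_norm_sub_rpow_le_of_norm_eq_one E hp hε
  refine ⟨K, hK, fun a b => ?_⟩
  wlog hba : ‖b‖ ≤ ‖a‖ generalizing a b
  · have := this b a (le_of_not_ge hba)
    rwa [norm_sub_rev, add_comm b a, add_comm (‖b‖ ^ p)] at this
  rcases (norm_nonneg a).eq_or_lt with ha | ha
  · have hb : ‖b‖ = 0 := le_antisymm (ha ▸ hba) (norm_nonneg b)
    have hsub := norm_sub_le a b
    have hmid := norm_midpoint_le a b
    rw [← ha, hb, add_zero] at hsub hmid
    rw [zero_div] at hmid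
    rw [le_antisymm hsub (norm_nonneg _), le_antisymm hmid (norm_nonneg _), ← ha, hb,
      Real.zero_rpow hp₀.ne']
    simp
  · have hscale : ∀ x : E, ‖‖a‖⁻¹ • x‖ ^ p = (‖a‖ ^ p)⁻¹ * ‖x‖ ^ p := fun x => by
      rw [norm_smul, norm_inv, norm_norm, Real.mul_rpow (by positivity) (norm_nonneg x),
        Real.inv_rpow ha.le]
    have hnorm : ∀ x : E, ‖‖a‖⁻¹ • x‖ = ‖a‖⁻¹ * ‖x‖ := fun x => by
      rw [norm_smul, norm_inv, norm_norm]
    have := hunit (a := ‖a‖⁻¹ • a) (b := ‖a‖⁻¹ • b) (by rw [hnorm, inv_mul_cancel₀ ha.ne'])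
      (by rwa [hnorm, inv_mul_le_one₀ ha])
    simp only [← smul_sub, ← smul_add, smul_comm (1 / 2 : ℝ), hscale] at this
    refine le_of_mul_le_mul_left (this.trans_eq ?_) (inv_pos.2 (Real.rpow_pos_of_pos ha p))
    ring

theorem uniformConvexSpace_of_exists_norm_sub_rpow_le {X : Type*} [SeminormedAddCommGroup X]
    [NormedSpace ℝ X] (hp : 0 < p)
    (h : ∀ ε > 0, ∃ K > 0, ∀ x y : X, ‖x - y‖ ^ p ≤ ε * (‖x‖ ^ p + ‖y‖ ^ p) +
      K * ((‖x‖ ^ p + ‖y‖ ^ p) / 2 - ‖(1 / 2 : ℝ) • (x + y)‖ ^ p)) :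
    UniformConvexSpace X where
  uniform_convex ε hε := by
    obtain ⟨K, hK, hKX⟩ := h (ε ^ p / 4) (by positivity)
    set q := max 0 (1 - ε ^ p / (2 * K))
    have hq : q < 1 := max_lt one_pos (sub_lt_self _ (by positivity))
    have hroot : q ^ p⁻¹ < 1 := Real.rpow_lt_one (le_max_left _ _) hq (inv_pos.2 hp)
    refine ⟨2 - 2 * q ^ p⁻¹, by linarith, fun x hx y hy hxy => ?_⟩
    have hmid : ‖(1 / 2 : ℝ) • (x + y)‖ ^ p ≤ q := by
      refine le_max_of_le_right ?_
      have hle := (Real.rpow_le_rpow hε.le hxy hp.le).trans (hKX x y)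
      rw [hx, hy, Real.one_rpow] at hle
      rw [le_sub_iff_add_le, ← le_sub_iff_add_le', div_le_iff₀ (by positivity)]
      linarith
    rw [← Real.le_rpow_inv_iff_of_pos (norm_nonneg _) (le_max_left _ _) hp, norm_smul,
      Real.norm_of_nonneg one_half_pos.le] at hmid
    linarith

theorem uniformConvexSpace_of_norm_map_eq {X Y 𝓕 : Type*} [SeminormedAddCommGroup X]
    [SeminormedAddCommGroup Y] [UniformConvexSpace Y] [FunLike 𝓕 X Y] [AddMonoidHomClass 𝓕 X Y]
    (φ : 𝓕) (hφ : ∀ x, ‖φ x‖ = ‖x‖) : UniformConvexSpace X := by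
  refine ⟨fun ε hε => ?_⟩
  obtain ⟨δ, hδ, hδ_le⟩ := UniformConvexSpace.uniform_convex (E := Y) hε
  refine ⟨δ, hδ, fun x hx y hy hxy => ?_⟩
  simp only [← hφ, map_sub, map_add] at hx hy hxy ⊢
  exact hδ_le hx hy hxy

theorem uniformConvexSpace_lp (Λ E : Type*) [NormedAddCommGroup E] [NormedSpace ℝ E]
    [UniformConvexSpace E] {p : ℝ≥0∞} [Fact (1 ≤ p)] (hp : 1 < p) (hp_top : p ≠ ⊤) :
    UniformConvexSpace (lp (fun _ : Λ => E) p) := by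
  have hp' : 1 < p.toReal := by simpa using ENNReal.toReal_strict_mono hp_top hp
  have hp₀ : 0 < p.toReal := one_pos.trans hp'
  refine uniformConvexSpace_of_exists_norm_sub_rpow_le hp₀ fun ε hε => ?_
  obtain ⟨K, hK, hKE⟩ := exists_norm_sub_rpow_le E hp' hε
  have hsum := lp.hasSum_norm (E := fun _ : Λ => E) hp₀
  refine ⟨K, hK, fun x y => ?_⟩
  have hxy := (hsum x).add (hsum y)
  exact hasSum_le (fun l => hKE (x l) (y l)) (hsum (x - y))
    ((hxy.mul_left ε).add (((hxy.div_const 2).sub (hsum ((1 / 2 : ℝ) • (x + y)))).mul_left K))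

end UniformConvexity

/-! ### Minimum-norm solutions and Tikhonov regularization in uniformly convex spaces -/

section MinimumNorm

variable {X H ι : Type*} [SeminormedAddCommGroup X] [NormedSpace ℝ X] [UniformConvexSpace X]
  [NormedAddCommGroup H] [NormedSpace ℝ H]

variable (X) in
theorem exists_norm_sub_lt_of_le_norm_midpoint {R τ : ℝ} (hR : 0 ≤ R) (hτ : 0 < τ) :
    ∃ η > 0, ∀ ⦃a b : X⦄, ‖a‖ ≤ R + η → ‖b‖ ≤ R + η → R - η ≤ ‖(1 / 2 : ℝ) • (a + b)‖ →
      ‖a - b‖ < τ := by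
  rcases hR.eq_or_lt with rfl | hR
  · exact ⟨τ / 4, by positivity, fun a b ha hb _ => by linarith [norm_sub_le a b]⟩
  obtain ⟨r, -, hr₁, hr⟩ :=
    exists_norm_midpoint_le_of_le_norm_sub X (ε := τ / (R + 1)) (by positivity)
  set η := min 1 (R * (1 - r) / 4)
  have hη₀ : 0 < η := lt_min one_pos (by nlinarith)
  have hη₁ : η ≤ 1 := min_le_left _ _
  have hηR : η ≤ R * (1 - r) / 4 := min_le_right _ _
  have hs : 0 < R + η := by positivity
  refine ⟨η, hη₀, fun a b ha hb hab => lt_of_not_ge fun hfar => ?_⟩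
  have hnorm : ∀ x : X, ‖(R + η)⁻¹ • x‖ = (R + η)⁻¹ * ‖x‖ := fun x => by
    rw [norm_smul, Real.norm_of_nonneg (inv_nonneg.2 hs.le)]
  have hmid := hr (a := (R + η)⁻¹ • a) (b := (R + η)⁻¹ • b)
    (by rwa [hnorm, inv_mul_le_one₀ hs]) (by rwa [hnorm, inv_mul_le_one₀ hs])
    (by
      rw [← smul_sub, hnorm, div_eq_inv_mul]
      gcongr)
  rw [← smul_add, smul_comm, hnorm, inv_mul_le_iff₀ hs] at hmid
  nlinarith

theorem cauchySeq_of_tendsto_norm {x : ℕ → X} {R : ℝ} (hx : Tendsto (‖x ·‖) atTop (𝓝 R))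
    (hmid : ∀ r < R, ∀ᶠ N in atTop, ∀ n ≥ N, r ≤ ‖(1 / 2 : ℝ) • (x n + x N)‖) : CauchySeq x := by
  rw [Metric.cauchySeq_iff']
  intro τ hτ
  obtain ⟨η, hη, hclose⟩ := exists_norm_sub_lt_of_le_norm_midpoint X
    (ge_of_tendsto' hx fun n => norm_nonneg (x n)) hτ
  have hle := eventually_forall_ge_atTop.2 (hx.eventually_le_const (lt_add_of_pos_right R hη))
  obtain ⟨N, hN, hN'⟩ := (hle.and (hmid (R - η) (sub_lt_self R hη))).exists
  exact ⟨N, fun n hn => by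
    rw [dist_eq_norm]
    exact hclose (hN n hn) (hN N le_rfl) (hN' n hn)⟩

theorem nonempty_iInter_of_antitone_of_convex [CompleteSpace X] {K : ℕ → Set X} (hK : Antitone K)
    (hne : ∀ n, (K n).Nonempty) (hclosed : ∀ n, IsClosed (K n)) (hconvex : ∀ n, Convex ℝ (K n))
    (hbdd : Bornology.IsBounded (K 0)) : (⋂ n, K n).Nonempty := by
  let ρ : ℕ → ℝ := fun n => Metric.infDist 0 (K n)
  have hρ_le : ∀ {n w}, w ∈ K n → ρ n ≤ ‖w‖ := fun hw => by
    simpa using Metric.infDist_le_dist_of_mem (x := 0) hw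
  have hρ_mono : Monotone ρ := fun m n hmn => Metric.infDist_le_infDist_of_subset (hK hmn) (hne n)
  obtain ⟨B, hB⟩ := hbdd.exists_norm_le
  have hρ_bdd : BddAbove (Set.range ρ) := ⟨B, by
    rintro _ ⟨n, rfl⟩
    obtain ⟨w, hw⟩ := hne n
    exact (hρ_le hw).trans (hB w (hK n.zero_le hw))⟩
  have hρ_lim := tendsto_atTop_ciSup hρ_mono hρ_bdd
  have hx : ∀ n, ∃ x ∈ K n, ‖x‖ < ρ n + 1 / ((n : ℝ) + 1) := fun n => by
    simpa using (Metric.infDist_lt_iff (x := 0) (hne n)).1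
      (lt_add_of_pos_right (ρ n) Nat.one_div_pos_of_nat)
  choose x hxK hxρ using hx
  have hnorm_lim : Tendsto (‖x ·‖) atTop (𝓝 (⨆ n, ρ n)) := by
    refine tendsto_of_tendsto_of_tendsto_of_le_of_le hρ_lim ?_ (fun n => hρ_le (hxK n))
      fun n => (hxρ n).le
    simpa using hρ_lim.add tendsto_one_div_add_atTop_nhds_zero_nat
  have hmid : ∀ r < ⨆ n, ρ n, ∀ᶠ N in atTop, ∀ n ≥ N, r ≤ ‖(1 / 2 : ℝ) • (x n + x N)‖ := by
    intro r hr
    filter_upwards [hρ_lim.eventually_const_lt hr] with N hN n hn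
    refine hN.le.trans (hρ_le ?_)
    rw [smul_add]
    exact hconvex N (hK hn (hxK n)) (hxK N) one_half_pos.le one_half_pos.le (add_halves 1)
  obtain ⟨y, hy⟩ := cauchySeq_tendsto_of_complete (cauchySeq_of_tendsto_norm hnorm_lim hmid)
  exact ⟨y, Set.mem_iInter.2 fun n => (hclosed n).mem_of_tendsto hy <|
    (eventually_ge_atTop n).mono fun m hm => hK hm (hxK m)⟩

theorem exists_lt_norm_of_norm_map_sub_le [CompleteSpace X] (f : X →L[ℝ] H) {u₀ : X}
    (hmin : ∀ w, f w = f u₀ → ‖u₀‖ ≤ ‖w‖) {r : ℝ} (hr : r < ‖u₀‖) :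
    ∃ ε > 0, ∀ w, ‖f w - f u₀‖ ≤ ε → r < ‖w‖ := by
  by_contra! hcon
  let K : ℕ → Set X := fun n =>
    f ⁻¹' Metric.closedBall (f u₀) (1 / ((n : ℝ) + 1)) ∩ Metric.closedBall 0 r
  have hK : Antitone K := fun m n hmn => Set.inter_subset_inter_left _ <|
    Set.preimage_mono <| Metric.closedBall_subset_closedBall <| Nat.one_div_le_one_div hmn
  have hne : ∀ n, (K n).Nonempty := fun n => by
    obtain ⟨w, hfw, hw⟩ := hcon _ (Nat.one_div_pos_of_nat (n := n))
    exact ⟨w, mem_closedBall_iff_norm.2 hfw, mem_closedBall_zero_iff.2 hw⟩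
  obtain ⟨w, hw⟩ := nonempty_iInter_of_antitone_of_convex hK hne
    (fun n => (Metric.isClosed_closedBall.preimage f.continuous).inter Metric.isClosed_closedBall)
    (fun n => ((convex_closedBall _ _).linear_preimage (f : X →ₗ[ℝ] H)).inter
      (convex_closedBall _ _))
    (Metric.isBounded_closedBall.subset Set.inter_subset_right)
  rw [Set.mem_iInter] at hw
  have hfw : dist (f w) (f u₀) ≤ 0 :=
    ge_of_tendsto' tendsto_one_div_add_atTop_nhds_zero_nat fun n => (hw n).1
  exact hr.not_ge ((hmin w (dist_le_zero.1 hfw)).trans (mem_closedBall_zero_iff.1 (hw 0).2))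

theorem tendsto_of_tendsto_map_of_norm_lt [CompleteSpace X] (f : X →L[ℝ] H) {u₀ : X}
    (hmin : ∀ w, f w = f u₀ → ‖u₀‖ ≤ ‖w‖) {l : Filter ι} {x : ι → X}
    (hfx : Tendsto (fun i => f (x i)) l (𝓝 (f u₀)))
    (hx : ∀ r > ‖u₀‖, ∀ᶠ i in l, ‖x i‖ < r) : Tendsto x l (𝓝 u₀) := by
  rw [Metric.tendsto_nhds]
  intro τ hτ
  obtain ⟨η, hη, hclose⟩ := exists_norm_sub_lt_of_le_norm_midpoint X (norm_nonneg u₀) hτ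
  obtain ⟨ε, hε, hlow⟩ := exists_lt_norm_of_norm_map_sub_le f hmin (sub_lt_self ‖u₀‖ hη)
  filter_upwards [hx _ (lt_add_of_pos_right _ hη), Metric.tendsto_nhds.1 hfx ε hε] with i hnorm hmap
  rw [dist_eq_norm] at hmap ⊢
  refine hclose hnorm.le (le_add_of_nonneg_right hη.le) (hlow _ ?_).le
  calc ‖f ((1 / 2 : ℝ) • (x i + u₀)) - f u₀‖ = ‖(1 / 2 : ℝ) • (f (x i) - f u₀)‖ := by
        congr 1
        rw [map_smul, map_add]
        module
    _ ≤ ε := by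
        rw [norm_smul, Real.norm_of_nonneg one_half_pos.le]
        linarith [norm_nonneg (f (x i) - f u₀)]

theorem tendsto_of_tikhonov_le [CompleteSpace X] (f : X →L[ℝ] H) {u₀ : X}
    (hmin : ∀ w, f w = f u₀ → ‖u₀‖ ≤ ‖w‖) {p : ℝ} (hp : 0 < p) {l : Filter ι} {α : ι → ℝ}
    {vδ : ι → H} {x : ι → X} (hα : Tendsto α l (𝓝[>] 0))
    (hdata : Tendsto (fun i => ‖f u₀ - vδ i‖ ^ 2 / α i) l (𝓝 0))
    (hx : ∀ᶠ i in l, ‖f (x i) - vδ i‖ ^ 2 + α i * ‖x i‖ ^ p ≤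
      ‖f u₀ - vδ i‖ ^ 2 + α i * ‖u₀‖ ^ p) :
    Tendsto x l (𝓝 u₀) := by
  have hα_pos : ∀ᶠ i in l, 0 < α i := hα.eventually self_mem_nhdsWithin
  have hα_zero : Tendsto α l (𝓝 0) := tendsto_nhds_of_tendsto_nhdsWithin hα
  have hnoise : Tendsto (fun i => ‖f u₀ - vδ i‖ ^ 2) l (𝓝 0) := by
    have := hdata.mul hα_zero
    rw [zero_mul] at this
    exact this.congr' (hα_pos.mono fun i hi => div_mul_cancel₀ _ hi.ne')
  have hresidual : Tendsto (fun i => ‖f (x i) - vδ i‖ ^ 2) l (𝓝 0) := by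
    refine squeeze_zero' (.of_forall fun i => by positivity) ?_
      (by simpa using hnoise.add (hα_zero.mul_const (‖u₀‖ ^ p)))
    filter_upwards [hx, hα_pos] with i hi hαi
    linarith [mul_nonneg hαi.le (Real.rpow_nonneg (norm_nonneg (x i)) p)]
  refine tendsto_of_tendsto_map_of_norm_lt f hmin ?_ fun r hr => ?_
  · rw [tendsto_iff_norm_sub_tendsto_zero]
    refine squeeze_zero (fun i => norm_nonneg _)
      (fun i => norm_sub_le_norm_sub_add_norm_sub _ (vδ i) _)
      (by simpa [norm_sub_rev] using hresidual.sqrt.add hnoise.sqrt)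
  · have hr₀ : 0 ≤ r := (norm_nonneg u₀).trans hr.le
    have hpow : 0 < r ^ p - ‖u₀‖ ^ p := sub_pos.2 (by gcongr)
    filter_upwards [hx, hα_pos, hdata.eventually_lt_const hpow] with i hi hαi hlt
    rw [div_lt_iff₀ hαi] at hlt
    refine (Real.rpow_lt_rpow_iff (norm_nonneg _) hr₀ hp).1 (lt_of_mul_lt_mul_left ?_ hαi.le)
    linarith [sq_nonneg ‖f (x i) - vδ i‖]

end MinimumNorm

section ParameterChoice

variable {ι : Type*} {l : Filter ι} {δ α : ι → ℝ} {c C : ℝ}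

theorem tendsto_nhdsGT_zero_of_le_of_le (hc : 0 < c) (hδ : Tendsto δ l (𝓝[>] 0))
    (hα : ∀ᶠ i in l, c * δ i ≤ α i ∧ α i ≤ C * δ i) : Tendsto α l (𝓝[>] 0) := by
  have hδ_pos : ∀ᶠ i in l, 0 < δ i := hδ.eventually self_mem_nhdsWithin
  have hδ_zero : Tendsto δ l (𝓝 0) := tendsto_nhds_of_tendsto_nhdsWithin hδ
  refine tendsto_nhdsWithin_iff.2 ⟨?_, ?_⟩
  · exact tendsto_of_tendsto_of_tendsto_of_le_of_le' (by simpa using hδ_zero.const_mul c)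
      (by simpa using hδ_zero.const_mul C) (hα.mono fun i hi => hi.1) (hα.mono fun i hi => hi.2)
  · filter_upwards [hα, hδ_pos] with i hi hδi using (mul_pos hc hδi).trans_le hi.1

theorem tendsto_sq_div_zero_of_le {e : ι → ℝ} (hc : 0 < c) (hδ : Tendsto δ l (𝓝[>] 0))
    (he : ∀ᶠ i in l, |e i| ≤ δ i) (hα : ∀ᶠ i in l, c * δ i ≤ α i) :
    Tendsto (fun i => e i ^ 2 / α i) l (𝓝 0) := by
  have hδ_pos : ∀ᶠ i in l, 0 < δ i := hδ.eventually self_mem_nhdsWithin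
  have hα_pos : ∀ᶠ i in l, 0 < α i := by
    filter_upwards [hα, hδ_pos] with i hi hδi using (mul_pos hc hδi).trans_le hi
  refine squeeze_zero' (hα_pos.mono fun i hi => by positivity) ?_
    (by simpa using (tendsto_nhds_of_tendsto_nhdsWithin hδ).div_const c)
  filter_upwards [hα, hδ_pos, he] with i hi hδi hei
  calc e i ^ 2 / α i ≤ δ i ^ 2 / (c * δ i) :=
        div_le_div₀ (sq_nonneg _) (sq_le_sq.2 (hei.trans (le_abs_self _))) (mul_pos hc hδi) hi
    _ = δ i / c := by field_simp

end ParameterChoice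

/-! ### High-pass filters on Schwartz functions -/

section TransposeMultiplier

open FourierTransform

variable {E : Type*} [NormedAddCommGroup E] [InnerProductSpace ℝ E] [FiniteDimensional ℝ E]
  [MeasurableSpace E] [BorelSpace E]

/-- The operator `φ ↦ 𝓕 (g 𝓕⁻¹ φ)` on Schwartz functions, the transpose of the Fourier multiplier
with symbol `g` on tempered distributions. -/
def transposeMultiplier (g : E → ℂ) : 𝓢(E, ℂ) →L[ℂ] 𝓢(E, ℂ) :=
  fourierCLM ℂ 𝓢(E, ℂ) ∘L SchwartzMap.smulLeftCLM ℂ g ∘L fourierInvCLM ℂ 𝓢(E, ℂ)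

theorem transposeMultiplier_one : transposeMultiplier (1 : E → ℂ) = .id ℂ 𝓢(E, ℂ) := by
  have hone : SchwartzMap.smulLeftCLM ℂ (1 : E → ℂ) = .id ℂ 𝓢(E, ℂ) := by
    ext φ x
    exact (SchwartzMap.smulLeftCLM_apply_apply (.const (1 : ℂ)) φ x).trans (one_smul ℂ (φ x))
  ext1 φ
  simp [transposeMultiplier, hone]

theorem transposeMultiplier_sub {g₁ g₂ : E → ℂ} (hg₁ : g₁.HasTemperateGrowth)
    (hg₂ : g₂.HasTemperateGrowth) :
    transposeMultiplier (g₁ - g₂) = transposeMultiplier g₁ - transposeMultiplier g₂ := by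
  simp only [transposeMultiplier, SchwartzMap.smulLeftCLM_sub hg₁ hg₂,
    ContinuousLinearMap.sub_comp, ContinuousLinearMap.comp_sub]

theorem transposeMultiplier_transposeMultiplier_apply {g₁ g₂ : E → ℂ}
    (hg₁ : g₁.HasTemperateGrowth) (hg₂ : g₂.HasTemperateGrowth) (φ : 𝓢(E, ℂ)) :
    transposeMultiplier g₁ (transposeMultiplier g₂ φ) = transposeMultiplier (g₁ * g₂) φ := by
  simp [transposeMultiplier, SchwartzMap.smulLeftCLM_smulLeftCLM_apply hg₁ hg₂]

end TransposeMultiplier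

section HighPass

variable {d : ℕ}

/-- The symbol `1 - χ(a ξ)`, which vanishes for `‖ξ‖ ≤ 1 / a`. -/
def highPass (d : ℕ) (a : ℝ) (ξ : Space d) : ℂ := 1 - (cutoff d (a • ξ) : ℂ)

theorem highPass_eq_zero {a : ℝ} {ξ : Space d} (h : ‖a • ξ‖ ≤ 1) : highPass d a ξ = 0 := by
  simp [highPass, (cutoff d).one_of_mem_closedBall (x := a • ξ) (by simpa [cutoff] using h)]

theorem highPass_eq_one {a : ℝ} {ξ : Space d} (h : 2 ≤ ‖a • ξ‖) : highPass d a ξ = 1 := by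
  simp [highPass, (cutoff d).zero_of_le_dist (x := a • ξ) (by simpa [cutoff] using h)]

theorem contDiff_highPass (d : ℕ) (a : ℝ) : ContDiff ℝ ∞ (highPass d a) :=
  contDiff_const.sub (Complex.ofRealCLM.contDiff.comp (contDiff_cutoff_smul d a))

theorem hasTemperateGrowth_highPass (d : ℕ) {a : ℝ} (ha : a ≠ 0) :
    (highPass d a).HasTemperateGrowth :=
  (Function.HasTemperateGrowth.const (1 : ℂ)).sub (Function.Complex.hasTemperateGrowth_ofReal.comp
    ((hasCompactSupport_cutoff_smul d ha).hasTemperateGrowth (contDiff_cutoff_smul d a)))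

theorem exists_norm_iteratedFDeriv_highPass_one_le (d n : ℕ) :
    ∃ B : ℝ, ∀ ξ, ‖iteratedFDeriv ℝ n (highPass d 1) ξ‖ ≤ B := by
  have hsmooth : ContDiff ℝ n fun ξ : Space d => (cutoff d ((1 : ℝ) • ξ) : ℂ) :=
    (Complex.ofRealCLM.contDiff.comp (contDiff_cutoff_smul d 1)).of_le (by exact_mod_cast le_top)
  have hsupp : HasCompactSupport fun ξ : Space d => (cutoff d ((1 : ℝ) • ξ) : ℂ) :=
    (hasCompactSupport_cutoff_smul d one_ne_zero).comp_left Complex.ofReal_zero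
  obtain ⟨B, hB⟩ := (hsupp.iteratedFDeriv (𝕜 := ℝ) n).exists_bound_of_continuous
    (hsmooth.continuous_iteratedFDeriv le_rfl)
  refine ⟨1 + B, fun ξ => ?_⟩
  change ‖iteratedFDeriv ℝ n
    ((fun _ => (1 : ℂ)) - fun ξ : Space d => (cutoff d ((1 : ℝ) • ξ) : ℂ)) ξ‖ ≤ 1 + B
  rw [iteratedFDeriv_sub_apply contDiff_const.contDiffAt hsmooth.contDiffAt]
  refine (norm_sub_le _ _).trans (add_le_add ?_ (hB ξ))
  rcases n.eq_zero_or_pos with rfl | hn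
  · simp
  · simp [iteratedFDeriv_const_of_ne hn.ne']

theorem exists_norm_iteratedFDeriv_highPass_le (d n N : ℕ) (A : ℝ) :
    ∃ B : ℝ, 0 ≤ B ∧ ∀ a ∈ Set.Ioc 0 A, ∀ ξ,
      ‖iteratedFDeriv ℝ n (highPass d a) ξ‖ ≤ B * (a * ‖ξ‖) ^ N := by
  obtain ⟨B, hB⟩ := exists_norm_iteratedFDeriv_highPass_one_le d n
  have hB_nonneg : 0 ≤ B := (norm_nonneg _).trans (hB 0)
  refine ⟨|A| ^ n * B, by positivity, fun a ⟨ha, haA⟩ ξ => ?_⟩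
  have hscale : highPass d a = fun ξ => highPass d 1 (a • ξ) := by
    simp only [highPass, one_smul, funext_iff, implies_true]
  rw [hscale, iteratedFDeriv_comp_const_smul a
    ((contDiff_highPass d 1).of_le (by exact_mod_cast le_top))]
  change ‖a ^ n • iteratedFDeriv ℝ n (highPass d 1) (a • ξ)‖ ≤ _
  rcases lt_or_ge (a * ‖ξ‖) 1 with hlt | hge
  · have hvanish : highPass d 1 =ᶠ[𝓝 (a • ξ)] 0 := by
      filter_upwards [(continuous_norm.tendsto (a • ξ)).eventually_le_const
        (by simpa [norm_smul, abs_of_pos ha] using hlt)] with η hη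
      exact highPass_eq_zero (by simpa using hη)
    rw [(hvanish.iteratedFDeriv ℝ n).eq_of_nhds]
    simp only [Pi.zero_def, iteratedFDeriv_fun_zero, Pi.zero_apply, smul_zero, norm_zero]
    positivity
  · rw [norm_smul, norm_pow, Real.norm_of_nonneg ha.le]
    calc a ^ n * ‖iteratedFDeriv ℝ n (highPass d 1) (a • ξ)‖ ≤ |A| ^ n * B := by
          gcongr
          exacts [haA.trans (le_abs_self A), hB _]
      _ ≤ |A| ^ n * B * (a * ‖ξ‖) ^ N :=
          le_mul_of_one_le_right (by positivity) (one_le_pow₀ hge)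

theorem exists_schwartzSeminorm_smulLeftCLM_highPass_le (k n N : ℕ) (A : ℝ) :
    ∃ P : Seminorm ℂ 𝓢(Space d, ℂ), Continuous P ∧ ∀ a ∈ Set.Ioc 0 A, ∀ ψ : 𝓢(Space d, ℂ),
      SchwartzMap.seminorm ℂ k n (SchwartzMap.smulLeftCLM ℂ (highPass d a) ψ) ≤ a ^ N * P ψ := by
  choose B hB_nonneg hB using fun i => exists_norm_iteratedFDeriv_highPass_le d i N A
  refine ⟨∑ i ∈ Finset.range (n + 1), ((n.choose i : ℝ≥0) * (B i).toNNReal) •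
    SchwartzMap.seminorm ℂ (k + N) (n - i), Seminorm.continuous_finsetSum fun i _ =>
      ((schwartz_withSeminorms ℂ (Space d) ℂ).continuous_seminorm (k + N, n - i)).const_smul _,
    fun a ha ψ => ?_⟩
  have hgrowth := hasTemperateGrowth_highPass d ha.1.ne'
  have ha_nonneg := ha.1.le
  refine SchwartzMap.seminorm_le_bound ℂ k n _ (mul_nonneg (by positivity) (apply_nonneg _ _))
    fun ξ => ?_
  rw [SchwartzMap.smulLeftCLM_apply hgrowth]
  have hLeibniz := norm_iteratedFDeriv_smul_le (𝕜 := ℝ) hgrowth.1 (ψ.smooth ⊤) ξ (n := n)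
    (by exact_mod_cast le_top)
  refine (mul_le_mul_of_nonneg_left hLeibniz (by positivity)).trans ?_
  rw [_root_.sum_apply, Finset.mul_sum, Finset.mul_sum]
  refine Finset.sum_le_sum fun i _ => ?_
  have hBi := hB_nonneg i
  rw [_root_.smul_apply, NNReal.smul_def, smul_eq_mul]
  push_cast
  rw [Real.coe_toNNReal _ hBi]
  calc ‖ξ‖ ^ k * ((n.choose i : ℝ) * ‖iteratedFDeriv ℝ i (highPass d a) ξ‖ *
        ‖iteratedFDeriv ℝ (n - i) ψ ξ‖)
      ≤ ‖ξ‖ ^ k * ((n.choose i : ℝ) * (B i * (a * ‖ξ‖) ^ N) *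
        ‖iteratedFDeriv ℝ (n - i) ψ ξ‖) := by
        gcongr
        exact hB i a ha ξ
    _ = a ^ N * (n.choose i * B i * (‖ξ‖ ^ (k + N) * ‖iteratedFDeriv ℝ (n - i) ψ ξ‖)) := by ring
    _ ≤ _ := by
        gcongr
        exact SchwartzMap.le_seminorm ℂ (k + N) (n - i) ψ ξ

theorem exists_seminorm_smulLeftCLM_highPass_le {Q : Seminorm ℂ 𝓢(Space d, ℂ)}
    (hQ : Continuous Q) (N : ℕ) (A : ℝ) :
    ∃ P : Seminorm ℂ 𝓢(Space d, ℂ), Continuous P ∧ ∀ a ∈ Set.Ioc 0 A, ∀ ψ : 𝓢(Space d, ℂ),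
      Q (SchwartzMap.smulLeftCLM ℂ (highPass d a) ψ) ≤ a ^ N * P ψ := by
  obtain ⟨s, C, -, hQle⟩ :=
    Seminorm.bound_of_continuous (schwartz_withSeminorms ℂ (Space d) ℂ) Q hQ
  choose P hP hPle using fun m : ℕ × ℕ =>
    exists_schwartzSeminorm_smulLeftCLM_highPass_le (d := d) m.1 m.2 N A
  refine ⟨C • ∑ m ∈ s, P m, (Seminorm.continuous_finsetSum fun m _ => hP m).const_smul C,
    fun a ha ψ => ?_⟩
  calc Q (SchwartzMap.smulLeftCLM ℂ (highPass d a) ψ)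
      ≤ C * (s.sup (schwartzSeminormFamily ℂ (Space d) ℂ))
        (SchwartzMap.smulLeftCLM ℂ (highPass d a) ψ) := hQle _
    _ ≤ C * ∑ m ∈ s, a ^ N * P m ψ := by
        gcongr
        refine (Seminorm.finset_sup_le_sum _ s _).trans ?_
        rw [_root_.sum_apply]
        exact Finset.sum_le_sum fun m _ => hPle m a ha ψ
    _ = a ^ N * (C • ∑ m ∈ s, P m) ψ := by
        rw [← Finset.mul_sum, _root_.smul_apply, _root_.sum_apply, NNReal.smul_def, smul_eq_mul,
          mul_left_comm]

theorem exists_seminorm_transposeMultiplier_highPass_le {Q : Seminorm ℂ 𝓢(Space d, ℂ)}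
    (hQ : Continuous Q) (N : ℕ) (A : ℝ) :
    ∃ P : Seminorm ℂ 𝓢(Space d, ℂ), Continuous P ∧ ∀ a ∈ Set.Ioc 0 A, ∀ φ : 𝓢(Space d, ℂ),
      Q (transposeMultiplier (highPass d a) φ) ≤ a ^ N * P φ := by
  obtain ⟨P, hP, hPle⟩ := exists_seminorm_smulLeftCLM_highPass_le
    (Q := Q.comp (FourierTransform.fourierCLM ℂ 𝓢(Space d, ℂ)).toLinearMap)
    (hQ.comp (FourierTransform.fourierCLM ℂ 𝓢(Space d, ℂ)).continuous) N A
  exact ⟨P.comp (FourierTransform.fourierInvCLM ℂ 𝓢(Space d, ℂ)).toLinearMap,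
    hP.comp (FourierTransform.fourierInvCLM ℂ 𝓢(Space d, ℂ)).continuous,
    fun a ha φ => hPle a ha _⟩

end HighPass

/-! ### The embedding of Besov spaces into the tempered distributions -/

section LittlewoodPaley

variable {d : ℕ}

theorem ofReal_dyadicSymbol_zero (d : ℕ) :
    (fun ξ => (dyadicSymbol d 0 ξ : ℂ)) = 1 - highPass d 1 := by
  ext ξ
  simp [highPass, dyadicSymbol]

theorem ofReal_dyadicSymbol_succ (d j : ℕ) :
    (fun ξ => (dyadicSymbol d (j + 1) ξ : ℂ)) =
      highPass d ((2⁻¹ : ℝ) ^ j) - highPass d ((2⁻¹ : ℝ) ^ (j + 1)) := by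
  ext ξ
  simp [highPass, dyadicSymbol]

theorem ofReal_dyadicSymbol_succ_mul_highPass (d j : ℕ) :
    (fun ξ => (dyadicSymbol d (j + 1) ξ : ℂ)) * highPass d (2 * (2⁻¹ : ℝ) ^ j) =
      fun ξ => (dyadicSymbol d (j + 1) ξ : ℂ) := by
  ext ξ
  rcases le_total 1 ‖(2⁻¹ : ℝ) ^ j • ξ‖ with hge | hle
  · have hone : highPass d (2 * (2⁻¹ : ℝ) ^ j) ξ = 1 :=
      highPass_eq_one (by rw [mul_smul, norm_smul, Real.norm_two]; linarith)
    rw [Pi.mul_apply, hone, mul_one]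
  · have hle' : ‖(2⁻¹ : ℝ) ^ (j + 1) • ξ‖ ≤ 1 := by
      rw [pow_succ', mul_smul, norm_smul, norm_inv, Real.norm_two]
      linarith
    have hzero : (dyadicSymbol d (j + 1) ξ : ℂ) = 0 := by
      rw [congrFun (ofReal_dyadicSymbol_succ d j) ξ, Pi.sub_apply, highPass_eq_zero hle,
        highPass_eq_zero hle', sub_zero]
    rw [Pi.mul_apply, hzero, zero_mul]

theorem lpBlock_apply (j : ℕ) (U : 𝓢'(Space d, ℂ)) (φ : 𝓢(Space d, ℂ)) :
    lpBlock j U φ = U (transposeMultiplier (fun ξ => (dyadicSymbol d j ξ : ℂ)) φ) :=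
  rfl

theorem lpBlock_zero_apply (U : 𝓢'(Space d, ℂ)) (φ : 𝓢(Space d, ℂ)) :
    lpBlock 0 U φ = U φ - U (transposeMultiplier (highPass d 1) φ) := by
  rw [lpBlock_apply, ofReal_dyadicSymbol_zero, transposeMultiplier_sub (g₁ := 1) (.const 1)
    (hasTemperateGrowth_highPass d one_ne_zero), transposeMultiplier_one, sub_apply, map_sub]
  rfl

theorem lpBlock_succ_apply (j : ℕ) (U : 𝓢'(Space d, ℂ)) (φ : 𝓢(Space d, ℂ)) :
    lpBlock (j + 1) U φ = U (transposeMultiplier (highPass d ((2⁻¹ : ℝ) ^ j)) φ) -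
      U (transposeMultiplier (highPass d ((2⁻¹ : ℝ) ^ (j + 1))) φ) := by
  rw [lpBlock_apply, ofReal_dyadicSymbol_succ,
    transposeMultiplier_sub (hasTemperateGrowth_highPass d (by positivity))
      (hasTemperateGrowth_highPass d (by positivity)), sub_apply, map_sub]

theorem lpBlock_succ_apply_transposeMultiplier_highPass (j : ℕ) (U : 𝓢'(Space d, ℂ))
    (φ : 𝓢(Space d, ℂ)) :
    lpBlock (j + 1) U (transposeMultiplier (highPass d (2 * (2⁻¹ : ℝ) ^ j)) φ) =
      lpBlock (j + 1) U φ := by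
  rw [lpBlock_apply, transposeMultiplier_transposeMultiplier_apply
    (hasTemperateGrowth_dyadicSymbol d _) (hasTemperateGrowth_highPass d (by positivity)),
    ofReal_dyadicSymbol_succ_mul_highPass, lpBlock_apply]

theorem sum_lpBlock_apply (U : 𝓢'(Space d, ℂ)) (φ : 𝓢(Space d, ℂ)) (J : ℕ) :
    ∑ j ∈ Finset.range (J + 1), lpBlock j U φ =
      U φ - U (transposeMultiplier (highPass d ((2⁻¹ : ℝ) ^ J)) φ) := by
  induction J with
  | zero => simp [lpBlock_zero_apply]
  | succ J ih =>
    rw [Finset.sum_range_succ, ih, lpBlock_succ_apply]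
    ring

theorem tendsto_sum_lpBlock_apply (U : 𝓢'(Space d, ℂ)) (φ : 𝓢(Space d, ℂ)) :
    Tendsto (fun J => ∑ j ∈ Finset.range (J + 1), lpBlock j U φ) atTop (𝓝 (U φ)) := by
  obtain ⟨P, -, hP⟩ := exists_seminorm_transposeMultiplier_highPass_le
    (Q := (normSeminorm ℂ ℂ).comp (U : 𝓢(Space d, ℂ) →ₗ[ℂ] ℂ))
    (continuous_norm.comp (map_continuous U)) 1 1
  simp_rw [sum_lpBlock_apply]
  suffices hzero : Tendsto (fun J : ℕ => U (transposeMultiplier (highPass d ((2⁻¹ : ℝ) ^ J)) φ))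
      atTop (𝓝 0) by
    simpa using hzero.const_sub (U φ)
  refine squeeze_zero_norm (a := fun J : ℕ => (2⁻¹ : ℝ) ^ J * P φ) (fun J => ?_) ?_
  · refine (hP ((2⁻¹ : ℝ) ^ J) ⟨by positivity, ?_⟩ φ).trans_eq (by rw [pow_one])
    exact pow_le_one₀ (by norm_num) (by norm_num)
  · simpa using (tendsto_pow_atTop_nhds_zero_of_lt_one (r := (2⁻¹ : ℝ)) (by norm_num)
      (by norm_num)).mul_const (P φ)

theorem enorm_apply_le_tsum_lpBlock (U : 𝓢'(Space d, ℂ)) (φ : 𝓢(Space d, ℂ)) :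
    ‖U φ‖ₑ ≤ ∑' j, ‖lpBlock j U φ‖ₑ :=
  le_of_tendsto (tendsto_sum_lpBlock_apply U φ).enorm (Eventually.of_forall fun _ =>
    (enorm_sum_le _ _).trans (ENNReal.sum_le_tsum _))

end LittlewoodPaley

section BesovEmbedding

variable {d : ℕ} {s p : ℝ}

theorem exists_seminorm_eLpNorm_le (q : ℝ≥0∞) :
    ∃ P : Seminorm ℂ 𝓢(Space d, ℂ), Continuous P ∧ ∀ φ : 𝓢(Space d, ℂ),
      eLpNorm φ q volume ≤ ENNReal.ofReal (P φ) := by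
  obtain ⟨k, C, hC⟩ := SchwartzMap.eLpNorm_le_seminorm (E := Space d) ℂ ℂ q volume
  refine ⟨C • (Finset.Iic (k, 0)).sup (schwartzSeminormFamily ℂ (Space d) ℂ),
    (Seminorm.continuous_finsetSup fun m _ =>
      (schwartz_withSeminorms ℂ (Space d) ℂ).continuous_seminorm m).const_smul C,
    fun φ => (hC φ).trans_eq ?_⟩
  rw [_root_.smul_apply, NNReal.smul_def, smul_eq_mul,
    ENNReal.ofReal_mul (p := (C : ℝ)) C.2, ENNReal.ofReal_coe_nnreal]

theorem enorm_apply_le_eLpNorm_mul {p q : ℝ≥0∞} [p.HolderConjugate q] {T : 𝓢'(Space d, ℂ)}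
    {g : Space d → ℂ} (hg : IsLpDensity p T g) (φ : 𝓢(Space d, ℂ)) :
    ‖T φ‖ₑ ≤ eLpNorm g p volume * eLpNorm φ q volume := by
  calc ‖T φ‖ₑ = ‖∫ x, g x * φ x‖ₑ := by simp only [hg.2 φ, mul_comm]
    _ ≤ ∫⁻ x, ‖g x * φ x‖ₑ := enorm_integral_le_lintegral_enorm _
    _ = eLpNorm (g • ⇑φ) 1 volume := eLpNorm_one_eq_lintegral_enorm.symm
    _ ≤ eLpNorm g p volume * eLpNorm φ q volume :=
        eLpNorm_smul_le_mul_eLpNorm φ.continuous.aestronglyMeasurable hg.1.1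

theorem enorm_apply_le_distLpNorm_mul {p q : ℝ≥0∞} [p.HolderConjugate q] (T : 𝓢'(Space d, ℂ))
    (φ : 𝓢(Space d, ℂ)) : ‖T φ‖ₑ ≤ distLpNorm p T * eLpNorm φ q volume := by
  rcases eq_or_ne (eLpNorm φ q volume) 0 with hzero | hne
  · have hφ : φ = 0 := by
      have hae := (eLpNorm_eq_zero_iff φ.continuous.aestronglyMeasurable
        (ENNReal.HolderConjugate.ne_zero q p)).1 hzero
      exact DFunLike.coe_injective ((φ.continuous.ae_eq_iff_eq volume continuous_zero).1 hae)
    simp [hφ]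
  · simp only [distLpNorm, ENNReal.iInf_mul_of_ne hne (φ.memLp q volume).2.ne]
    exact le_iInf₂ fun g hg => enorm_apply_le_eLpNorm_mul hg φ

theorem distLpNorm_lpBlock_le (hp : 0 < p) (U : 𝓢'(Space d, ℂ)) (j : ℕ) :
    distLpNorm (ENNReal.ofReal p) (lpBlock j U) ≤
      ENNReal.ofReal ((2 : ℝ) ^ (-(j * s))) * besovNormWhole s p U := by
  have hterm : ENNReal.ofReal ((2 : ℝ) ^ (j * s)) *
      distLpNorm (ENNReal.ofReal p) (lpBlock j U) ≤ besovNormWhole s p U := by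
    rw [besovNormWhole, one_div, ENNReal.le_rpow_inv_iff hp]
    exact ENNReal.le_tsum j
  refine le_trans (le_of_eq ?_) (mul_le_mul_right hterm _)
  rw [← mul_assoc, ← ENNReal.ofReal_mul (by positivity), ← Real.rpow_add two_pos, neg_add_cancel,
    Real.rpow_zero, ENNReal.ofReal_one, one_mul]

theorem enorm_lpBlock_apply_le {q : ℝ≥0∞} [(ENNReal.ofReal p).HolderConjugate q] (hp : 0 < p)
    (U : 𝓢'(Space d, ℂ)) (j : ℕ) (φ : 𝓢(Space d, ℂ)) :
    ‖lpBlock j U φ‖ₑ ≤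
      ENNReal.ofReal ((2 : ℝ) ^ (-(j * s))) * besovNormWhole s p U * eLpNorm φ q volume := by
  refine (enorm_apply_le_distLpNorm_mul (p := ENNReal.ofReal p) (q := q) _ φ).trans ?_
  gcongr
  exact distLpNorm_lpBlock_le hp U j

theorem two_rpow_neg_mul_mul_pow_le {N : ℕ} (hN : 1 - s ≤ N) (j : ℕ) :
    (2 : ℝ) ^ (-((j + 1 : ℕ) * s)) * (2 * (2⁻¹ : ℝ) ^ j) ^ N ≤
      2 ^ (2 * N) * (2⁻¹ : ℝ) ^ (j + 1) := by
  have hlhs : (2 * (2⁻¹ : ℝ) ^ j) ^ N = (2 : ℝ) ^ ((N : ℝ) - j * N) := by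
    rw [mul_pow, ← pow_mul, inv_pow, Real.rpow_sub two_pos, ← Nat.cast_mul, Real.rpow_natCast,
      Real.rpow_natCast, div_eq_mul_inv]
  have hrhs : 2 ^ (2 * N) * (2⁻¹ : ℝ) ^ (j + 1) = (2 : ℝ) ^ (2 * (N : ℝ) - (j + 1)) := by
    rw [inv_pow, Real.rpow_sub two_pos, div_eq_mul_inv]
    norm_cast
  rw [hlhs, hrhs, ← Real.rpow_add two_pos]
  refine Real.rpow_le_rpow_of_exponent_le one_le_two ?_
  push_cast
  nlinarith [mul_le_mul_of_nonneg_left hN (by positivity : (0 : ℝ) ≤ (j : ℝ) + 1)]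

theorem exists_seminorm_enorm_lpBlock_succ_apply_le (d : ℕ) (s : ℝ) (hp : 1 ≤ p) :
    ∃ P : Seminorm ℂ 𝓢(Space d, ℂ), Continuous P ∧
      ∀ (U : 𝓢'(Space d, ℂ)) (φ : 𝓢(Space d, ℂ)) (j : ℕ),
        ‖lpBlock (j + 1) U φ‖ₑ ≤
          besovNormWhole s p U * ENNReal.ofReal (P φ) * 2⁻¹ ^ (j + 1) := by
  obtain ⟨q, hpq⟩ : ∃ q, (ENNReal.ofReal p).HolderConjugate q :=
    ⟨_, .inv_one_sub_inv' (ENNReal.one_le_ofReal.2 hp)⟩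
  obtain ⟨Q, hQ, hQle⟩ := exists_seminorm_eLpNorm_le (d := d) q
  obtain ⟨N, hN⟩ := exists_nat_ge (1 - s)
  obtain ⟨P, hP, hPle⟩ := exists_seminorm_transposeMultiplier_highPass_le hQ N 2
  refine ⟨(2 ^ (2 * N) : ℝ≥0) • P, hP.const_smul _, fun U φ j => ?_⟩
  have hP_nonneg : 0 ≤ P φ := apply_nonneg P φ
  have ha : 2 * (2⁻¹ : ℝ) ^ j ∈ Set.Ioc 0 2 :=
    ⟨by positivity, mul_le_of_le_one_right zero_le_two (pow_le_one₀ (by norm_num) (by norm_num))⟩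
  -- A filter that passes the frequencies of the block does not change it, and its factor `a ^ N`
  -- with `N ≥ 1 - s` outweighs the growth of `2 ^ (-j s)`.
  rw [← lpBlock_succ_apply_transposeMultiplier_highPass]
  calc _ ≤ ENNReal.ofReal ((2 : ℝ) ^ (-((j + 1 : ℕ) * s))) * besovNormWhole s p U *
        eLpNorm (transposeMultiplier (highPass d (2 * (2⁻¹ : ℝ) ^ j)) φ) q volume :=
        enorm_lpBlock_apply_le (zero_lt_one.trans_le hp) U (j + 1) _
    _ ≤ ENNReal.ofReal ((2 : ℝ) ^ (-((j + 1 : ℕ) * s))) * besovNormWhole s p U *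
        ENNReal.ofReal ((2 * (2⁻¹ : ℝ) ^ j) ^ N * P φ) := by
        gcongr
        exact (hQle _).trans (ENNReal.ofReal_le_ofReal (hPle _ ha φ))
    _ = besovNormWhole s p U * ENNReal.ofReal
        ((2 : ℝ) ^ (-((j + 1 : ℕ) * s)) * (2 * (2⁻¹ : ℝ) ^ j) ^ N * P φ) := by
        rw [mul_comm _ (besovNormWhole s p U), mul_assoc, ← ENNReal.ofReal_mul (by positivity),
          mul_assoc]
    _ ≤ besovNormWhole s p U * ENNReal.ofReal (2 ^ (2 * N) * (2⁻¹ : ℝ) ^ (j + 1) * P φ) := by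
        gcongr _ * ENNReal.ofReal ?_
        exact mul_le_mul_of_nonneg_right (two_rpow_neg_mul_mul_pow_le hN j) hP_nonneg
    _ = _ := by
        rw [mul_right_comm (2 ^ (2 * N) : ℝ), ENNReal.ofReal_mul (by positivity),
          ENNReal.ofReal_pow (by norm_num), ENNReal.ofReal_inv_of_pos two_pos,
          ENNReal.ofReal_ofNat, mul_assoc]
        rfl

theorem exists_seminorm_enorm_apply_le_besovNormWhole_mul (d : ℕ) (s : ℝ) (hp : 1 ≤ p) :
    ∃ P : Seminorm ℂ 𝓢(Space d, ℂ), Continuous P ∧ ∀ (U : 𝓢'(Space d, ℂ)) (φ : 𝓢(Space d, ℂ)),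
      ‖U φ‖ₑ ≤ besovNormWhole s p U * ENNReal.ofReal (P φ) := by
  obtain ⟨q, hpq⟩ : ∃ q, (ENNReal.ofReal p).HolderConjugate q :=
    ⟨_, .inv_one_sub_inv' (ENNReal.one_le_ofReal.2 hp)⟩
  obtain ⟨Q, hQ, hQle⟩ := exists_seminorm_eLpNorm_le (d := d) q
  obtain ⟨P, hP, hPle⟩ := exists_seminorm_enorm_lpBlock_succ_apply_le d s hp
  refine ⟨Q + P, hQ.add hP, fun U φ => ?_⟩
  have hzero : ‖lpBlock 0 U φ‖ₑ ≤ besovNormWhole s p U * ENNReal.ofReal (Q φ) := by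
    refine (enorm_lpBlock_apply_le (s := s) (q := q) (zero_lt_one.trans_le hp) U 0 φ).trans ?_
    simpa using mul_le_mul_right (hQle φ) _
  calc ‖U φ‖ₑ ≤ ∑' j, ‖lpBlock j U φ‖ₑ := enorm_apply_le_tsum_lpBlock U φ
    _ = ‖lpBlock 0 U φ‖ₑ + ∑' j, ‖lpBlock (j + 1) U φ‖ₑ := tsum_eq_zero_add' ENNReal.summable
    _ ≤ besovNormWhole s p U * ENNReal.ofReal (Q φ) +
        ∑' j : ℕ, besovNormWhole s p U * ENNReal.ofReal (P φ) * 2⁻¹ ^ (j + 1) :=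
        add_le_add hzero (ENNReal.tsum_le_tsum fun j => hPle U φ j)
    _ = besovNormWhole s p U * ENNReal.ofReal ((Q + P) φ) := by
        rw [ENNReal.tsum_mul_left, ENNReal.tsum_geometric_add_one, ENNReal.one_sub_inv_two, inv_inv,
          ENNReal.inv_mul_cancel two_ne_zero ENNReal.ofNat_ne_top, mul_one, ← mul_add,
          ← ENNReal.ofReal_add (apply_nonneg Q φ) (apply_nonneg P φ)]
        rfl

end BesovEmbedding

/-! ### Completeness of Besov spaces -/

section Series

theorem tsum_rpow_tsum_le {ι κ : Type*} {p : ℝ} (hp : 1 ≤ p) (a : ι → κ → ℝ≥0∞) :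
    (∑' k, (∑' i, a i k) ^ p) ^ (1 / p) ≤ ∑' i, (∑' k, a i k ^ p) ^ (1 / p) := by
  have hp_pos : 0 < p := zero_lt_one.trans_le hp
  have finite_case (s : Finset κ) (t : Finset ι) : (∑ k ∈ s, (∑ i ∈ t, a i k) ^ p) ^ (1 / p) ≤
      ∑ i ∈ t, (∑ k ∈ s, a i k ^ p) ^ (1 / p) := by
    classical
    induction t using Finset.induction_on with
    | empty => simp [hp_pos]
    | insert i t hi ih =>
      simp only [Finset.sum_insert hi]
      exact (ENNReal.Lp_add_le s (a i) (fun k => ∑ i ∈ t, a i k) hp).trans (by gcongr)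
  simp only [one_div] at finite_case ⊢
  rw [ENNReal.rpow_inv_le_iff hp_pos, ENNReal.tsum_eq_iSup_sum]
  refine iSup_le fun s => ?_
  rw [← ENNReal.rpow_inv_le_iff hp_pos]
  have hlim : Tendsto (fun t : Finset ι => (∑ k ∈ s, (∑ i ∈ t, a i k) ^ p) ^ p⁻¹) atTop
      (𝓝 ((∑ k ∈ s, (∑' i, a i k) ^ p) ^ p⁻¹)) :=
    (ENNReal.continuous_rpow_const.tendsto _).comp (tendsto_finsetSum s fun k _ =>
      (ENNReal.continuous_rpow_const.tendsto _).comp ENNReal.summable.hasSum)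
  refine le_of_tendsto' hlim fun t => ?_
  calc (∑ k ∈ s, (∑ i ∈ t, a i k) ^ p) ^ p⁻¹
      ≤ ∑ i ∈ t, (∑ k ∈ s, a i k ^ p) ^ p⁻¹ := finite_case s t
    _ ≤ ∑' i, (∑ k ∈ s, a i k ^ p) ^ p⁻¹ := ENNReal.sum_le_tsum t
    _ ≤ ∑' i, (∑' k, a i k ^ p) ^ p⁻¹ := by
        gcongr
        exact ENNReal.sum_le_tsum s

theorem iInf_tsum_le_tsum_iInf {ι : Type*} [Countable ι] {κ : ι → Type*}
    (f : ∀ i, κ i → ℝ≥0∞) : ⨅ k : ∀ i, κ i, ∑' i, f i (k i) ≤ ∑' i, ⨅ k, f i k := by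
  refine ENNReal.le_of_forall_pos_le_add fun ε hε hfin => ?_
  obtain ⟨ε', hε', hε'_sum⟩ := ENNReal.exists_pos_sum_of_countable' (ENNReal.coe_pos.2 hε).ne' ι
  have near_inf (i : ι) : ∃ k, f i k < (⨅ k, f i k) + ε' i :=
    iInf_lt_iff.1 (ENNReal.lt_add_right (ENNReal.ne_top_of_tsum_ne_top hfin.ne i) (hε' i).ne')
  choose k hk using near_inf
  calc ⨅ k : ∀ i, κ i, ∑' i, f i (k i) ≤ ∑' i, f i (k i) := iInf_le _ k
    _ ≤ ∑' i, ((⨅ k, f i k) + ε' i) := ENNReal.tsum_le_tsum fun i => (hk i).le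
    _ = (∑' i, ⨅ k, f i k) + ∑' i, ε' i := ENNReal.tsum_add
    _ ≤ (∑' i, ⨅ k, f i k) + ε := by gcongr

end Series

section SeriesWholeSpace

variable {d : ℕ}

theorem hasSum_integral_mul {p : ℝ≥0∞} [Fact (1 ≤ p)] {ι : Type*}
    {G : ι → Lp ℂ p (volume : Measure (Space d))} (hG : Summable G) (φ : 𝓢(Space d, ℂ)) :
    HasSum (fun n => ∫ x, φ x * G n x) (∫ x, φ x * (∑' n, G n) x) := by
  have h := (hG.hasSum.mapL (Lp.toTemperedDistributionCLM ℂ volume p)).mapL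
    (PointwiseConvergenceCLM.evalCLM (RingHom.id ℂ) ℂ φ)
  have integral_eq (F : Lp ℂ p (volume : Measure (Space d))) :
      PointwiseConvergenceCLM.evalCLM (RingHom.id ℂ) ℂ φ
        (Lp.toTemperedDistributionCLM ℂ volume p F) = ∫ x, φ x * F x :=
    Lp.toTemperedDistribution_apply F φ
  simpa only [integral_eq] using h

theorem distLpNorm_le_tsum_eLpNorm {p : ℝ≥0∞} (hp : 1 ≤ p) {ι : Type*} {T : ι → 𝓢'(Space d, ℂ)}
    {S : 𝓢'(Space d, ℂ)} (hS : ∀ φ, HasSum (fun n => T n φ) (S φ)) {g : ι → Space d → ℂ}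
    (hg : ∀ n, IsLpDensity p (T n) (g n)) : distLpNorm p S ≤ ∑' n, eLpNorm (g n) p volume := by
  by_cases hfin : ∑' n, eLpNorm (g n) p volume = ⊤
  · exact hfin ▸ le_top
  have : Fact (1 ≤ p) := ⟨hp⟩
  let G (n : ι) : Lp ℂ p (volume : Measure (Space d)) := (hg n).1.toLp (g n)
  have enorm_G (n : ι) : ‖G n‖ₑ = eLpNorm (g n) p volume := Lp.enorm_toLp _
  have hG : Summable G := Summable.of_enorm (by simpa only [enorm_G] using hfin)
  have hdensity : IsLpDensity p S (∑' n, G n : Lp ℂ p (volume : Measure (Space d))) := by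
    refine ⟨Lp.memLp _, fun φ => (hS φ).unique ?_⟩
    have hT (n : ι) : T n φ = ∫ x, φ x * G n x := by
      rw [(hg n).2 φ]
      exact integral_congr_ae ((hg n).1.coeFn_toLp.mono fun x hx => by simp only [G, hx])
    simpa only [hT] using hasSum_integral_mul hG φ
  calc distLpNorm p S ≤ ‖∑' n, G n‖ₑ := Lp.enorm_def (∑' n, G n) ▸ iInf₂_le _ hdensity
    _ ≤ ∑' n, ‖G n‖ₑ := enorm_tsum_le_tsum_enorm
    _ = ∑' n, eLpNorm (g n) p volume := tsum_congr enorm_G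

theorem distLpNorm_le_tsum {p : ℝ≥0∞} (hp : 1 ≤ p) {ι : Type*} [Countable ι]
    {T : ι → 𝓢'(Space d, ℂ)} {S : 𝓢'(Space d, ℂ)} (hS : ∀ φ, HasSum (fun n => T n φ) (S φ)) :
    distLpNorm p S ≤ ∑' n, distLpNorm p (T n) := by
  simp only [distLpNorm, iInf_subtype']
  refine le_trans (le_iInf fun g => ?_) (iInf_tsum_le_tsum_iInf _)
  simpa only [distLpNorm, iInf_subtype'] using
    distLpNorm_le_tsum_eLpNorm hp hS fun n => (g n).2

variable {s p : ℝ} {ι : Type*} {U : ι → 𝓢'(Space d, ℂ)}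

theorem besovNormWhole_le_tsum [Countable ι] (hp : 1 ≤ p) {S : 𝓢'(Space d, ℂ)}
    (hS : ∀ φ, HasSum (fun n => U n φ) (S φ)) :
    besovNormWhole s p S ≤ ∑' n, besovNormWhole s p (U n) := by
  refine le_trans ?_ (tsum_rpow_tsum_le hp fun n (j : ℕ) =>
    ENNReal.ofReal ((2 : ℝ) ^ ((j : ℝ) * s)) * distLpNorm (ENNReal.ofReal p) (lpBlock j (U n)))
  refine ENNReal.rpow_le_rpow (ENNReal.tsum_le_tsum fun j => ?_) (by positivity)
  rw [ENNReal.tsum_mul_left]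
  gcongr
  exact distLpNorm_le_tsum (ENNReal.one_le_ofReal.2 hp) fun φ => hS _

theorem exists_hasSum_of_tsum_besovNormWhole_ne_top (hp : 1 ≤ p)
    (hU : ∑' n, besovNormWhole s p (U n) ≠ ⊤) :
    ∃ S : 𝓢'(Space d, ℂ), ∀ φ, HasSum (fun n => U n φ) (S φ) := by
  obtain ⟨P, hP, hPle⟩ := exists_seminorm_enorm_apply_le_besovNormWhole_mul d s hp
  set B := ∑' n, besovNormWhole s p (U n)
  have tsum_enorm_le (φ : 𝓢(Space d, ℂ)) : ∑' n, ‖U n φ‖ₑ ≤ B * ENNReal.ofReal (P φ) := by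
    rw [← ENNReal.tsum_mul_right]
    exact ENNReal.tsum_le_tsum fun n => hPle (U n) φ
  have hsum (φ : 𝓢(Space d, ℂ)) : Summable fun n => U n φ :=
    Summable.of_enorm (ne_top_of_le_ne_top (by finiteness) (tsum_enorm_le φ))
  have norm_tsum_le (φ : 𝓢(Space d, ℂ)) : ‖∑' n, U n φ‖ ≤ B.toReal * P φ := by
    have h := ENNReal.toReal_mono (by finiteness) (enorm_tsum_le_tsum_enorm.trans (tsum_enorm_le φ))
    rwa [toReal_enorm, ENNReal.toReal_mul, ENNReal.toReal_ofReal (apply_nonneg P φ)] at h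
  obtain ⟨t, C, -, hC⟩ := Seminorm.bound_of_continuous (schwartz_withSeminorms ℂ (Space d) ℂ) P hP
  let S : 𝓢(Space d, ℂ) →L[ℂ] ℂ := SchwartzMap.mkCLMtoNormedSpace (σ := RingHom.id ℂ)
    (fun φ => ∑' n, U n φ)
    (fun φ ψ => by simp only [map_add, (hsum φ).tsum_add (hsum ψ)])
    (fun c φ => by simpa only [map_smul, RingHom.id_apply] using (hsum φ).tsum_const_smul c)
    ⟨t, B.toReal * C, by positivity, fun φ => (norm_tsum_le φ).trans <| by
      rw [mul_assoc]
      exact mul_le_mul_of_nonneg_left (hC φ) ENNReal.toReal_nonneg⟩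
  exact ⟨ContinuousLinearMap.toPointwiseConvergenceCLM _ _ _ _ S, fun φ => (hsum φ).hasSum⟩

end SeriesWholeSpace

section Restriction

open ContDiffMapSupportedIn

variable {𝕜 : Type*} [RCLike 𝕜] {d : ℕ} {Ω : Opens (Space d)}

@[simp]
theorem testToSchwartz_apply (φ : 𝓓(Ω, ℝ)) (x : Space d) : testToSchwartz φ x = ((φ x : ℝ) : ℂ) :=
  rfl

theorem testToSchwartz_add (φ ψ : 𝓓(Ω, ℝ)) :
    testToSchwartz (φ + ψ) = testToSchwartz φ + testToSchwartz ψ := by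
  ext x
  simp

theorem testToSchwartz_smul (c : ℝ) (φ : 𝓓(Ω, ℝ)) :
    testToSchwartz (c • φ) = c • testToSchwartz φ := by
  ext x
  simp

theorem seminorm_testToSchwartz_ofSupportedIn_le {K : Compacts (Space d)}
    (hK : (K : Set (Space d)) ⊆ Ω) {R : ℝ≥0} (hR : ∀ x ∈ K, ‖x‖ ≤ R) (k n : ℕ)
    (f : 𝓓^{⊤}_{K}(Space d, ℝ)) :
    SchwartzMap.seminorm ℝ k n (testToSchwartz (TestFunction.ofSupportedIn hK f : 𝓓(Ω, ℝ))) ≤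
      R ^ k * ContDiffMapSupportedIn.seminorm ℝ (Space d) ℝ ⊤ K n f := by
  refine SchwartzMap.seminorm_le_bound ℝ k n _ (by positivity) fun x => ?_
  have norm_iteratedFDeriv_eq : ‖iteratedFDeriv ℝ n
      (testToSchwartz (TestFunction.ofSupportedIn hK f : 𝓓(Ω, ℝ))) x‖ = ‖iteratedFDeriv ℝ n f x‖ :=
    Complex.ofRealLI.norm_iteratedFDeriv_comp_left f.contDiff.contDiffAt (by exact_mod_cast le_top)
  rw [norm_iteratedFDeriv_eq]
  by_cases hx : x ∈ K
  · gcongr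
    · exact hR x hx
    · exact norm_iteratedFDeriv_apply_le_seminorm_top ℝ
  · rw [show iteratedFDeriv ℝ n f x = 0 from f.iteratedFDeriv_zero_on_compl hx, norm_zero, mul_zero]
    positivity

theorem continuous_testToSchwartz_ofSupportedIn {K : Compacts (Space d)}
    (hK : (K : Set (Space d)) ⊆ Ω) :
    Continuous fun f : 𝓓^{⊤}_{K}(Space d, ℝ) =>
      testToSchwartz (TestFunction.ofSupportedIn hK f : 𝓓(Ω, ℝ)) := by
  let A : 𝓓^{⊤}_{K}(Space d, ℝ) →ₗ[ℝ] 𝓢(Space d, ℂ) :=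
    { toFun := fun f => testToSchwartz (TestFunction.ofSupportedIn hK f : 𝓓(Ω, ℝ))
      map_add' := fun f g => testToSchwartz_add
        (TestFunction.ofSupportedIn hK f : 𝓓(Ω, ℝ)) (TestFunction.ofSupportedIn hK g)
      map_smul' := fun c f =>
        testToSchwartz_smul c (TestFunction.ofSupportedIn hK f : 𝓓(Ω, ℝ)) }
  obtain ⟨R, hR⟩ := K.isCompact.isBounded.exists_norm_le
  refine WithSeminorms.continuous_of_isBounded (ContDiffMapSupportedIn.withSeminorms ℝ _ _ _ _)
    (schwartz_withSeminorms ℝ (Space d) ℂ) A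
    fun m => ⟨{m.2}, R.toNNReal ^ m.1, fun f => ?_⟩
  rw [Finset.sup_singleton, _root_.smul_apply, NNReal.smul_def, smul_eq_mul, NNReal.coe_pow]
  exact seminorm_testToSchwartz_ofSupportedIn_le hK
    (fun x hx => (hR x hx).trans (Real.le_coe_toNNReal R)) m.1 m.2 f

variable (Ω) in
/-- The extension by zero of test functions on `Ω`, as a continuous linear map into the complex
Schwartz functions; its transpose restricts tempered distributions to `Ω`. -/
def testToSchwartzCLM : 𝓓(Ω, ℝ) →L[ℝ] 𝓢(Space d, ℂ) :=
  TestFunction.mkCLM ℝ testToSchwartz testToSchwartz_add testToSchwartz_smul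
    fun _ => continuous_testToSchwartz_ofSupportedIn

theorem map_map_complex (z : 𝕜) : RCLike.map ℂ 𝕜 (RCLike.map 𝕜 ℂ z) = z := by
  simp [RCLike.map_apply]

variable (𝕜 Ω) in
/-- The restriction to `Ω` of a tempered distribution, as a `𝕜`-valued distribution. For `𝕜 = ℝ`
this keeps the real part, so it is a restriction in the sense of `IsRestriction` only if the
values on real test functions are real. -/
def restrictDist (U : 𝓢'(Space d, ℂ)) : 𝓓'(Ω, 𝕜) :=
  let U' : 𝓢(Space d, ℂ) →L[ℂ] ℂ := U
  RCLike.map ℂ 𝕜 ∘L U'.restrictScalars ℝ ∘L testToSchwartzCLM Ω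

theorem restrictDist_apply (U : 𝓢'(Space d, ℂ)) (φ : 𝓓(Ω, ℝ)) :
    restrictDist 𝕜 Ω U φ = RCLike.map ℂ 𝕜 (U (testToSchwartz φ)) :=
  rfl

variable {ι : Type*} {T : ι → 𝓓'(Ω, 𝕜)} {U : ι → 𝓢'(Space d, ℂ)} {V : 𝓢'(Space d, ℂ)}

theorem hasSum_restrictDist (hU : ∀ n, IsRestriction (U n) (T n))
    (hV : ∀ φ, HasSum (fun n => U n φ) (V φ)) (φ : 𝓓(Ω, ℝ)) :
    HasSum (fun n => T n φ) (restrictDist 𝕜 Ω V φ) := by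
  have h := (hV (testToSchwartz φ)).mapL (RCLike.map ℂ 𝕜)
  simp only [← hU _ φ, map_map_complex] at h
  rwa [restrictDist_apply]

theorem isRestriction_of_hasSum {S : 𝓓'(Ω, 𝕜)} (hU : ∀ n, IsRestriction (U n) (T n))
    (hV : ∀ φ, HasSum (fun n => U n φ) (V φ)) (hS : ∀ φ, HasSum (fun n => T n φ) (S φ)) :
    IsRestriction V S := fun φ => by
  have h := (hS φ).mapL (RCLike.map 𝕜 ℂ)
  simp only [hU _ φ] at h
  exact h.unique (hV (testToSchwartz φ))

end Restriction

section SeriesDomain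

variable {𝕜 : Type*} [RCLike 𝕜] {d : ℕ} {Ω : Opens (Space d)} {s p : ℝ}

theorem eq_zero_of_besovNorm_eq_zero (hp : 1 ≤ p) {T : 𝓓'(Ω, 𝕜)} (hT : besovNorm s p T = 0) :
    T = 0 := by
  obtain ⟨P, -, hP⟩ := exists_seminorm_enorm_apply_le_besovNormWhole_mul d s hp
  refine DFunLike.ext _ _ fun φ => ?_
  have hle : ‖RCLike.map 𝕜 ℂ (T φ)‖ₑ / ENNReal.ofReal (P (testToSchwartz φ)) ≤ besovNorm s p T :=
    le_iInf₂ fun U hU => ENNReal.div_le_of_le_mul (hU φ ▸ hP U (testToSchwartz φ))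
  have hzero : RCLike.map 𝕜 ℂ (T φ) = 0 := by
    rw [hT, nonpos_iff_eq_zero, ENNReal.div_eq_zero_iff] at hle
    exact enorm_eq_zero.1 (hle.resolve_right ENNReal.ofReal_ne_top)
  calc T φ = RCLike.map ℂ 𝕜 (RCLike.map 𝕜 ℂ (T φ)) := (map_map_complex _).symm
    _ = 0 := by rw [hzero, map_zero]

variable {ι : Type*} [Countable ι] {T : ι → 𝓓'(Ω, 𝕜)}

theorem exists_hasSum_of_tsum_besovNorm_ne_top (hp : 1 ≤ p)
    (hT : ∑' n, besovNorm s p (T n) ≠ ⊤) :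
    ∃ S : 𝓓'(Ω, 𝕜), ∀ φ, HasSum (fun n => T n φ) (S φ) := by
  simp only [besovNorm, iInf_subtype'] at hT
  obtain ⟨U, hU⟩ := iInf_lt_iff.1 ((iInf_tsum_le_tsum_iInf _).trans_lt hT.lt_top)
  obtain ⟨V, hV⟩ := exists_hasSum_of_tsum_besovNormWhole_ne_top hp hU.ne
  exact ⟨restrictDist 𝕜 Ω V, hasSum_restrictDist (fun n => (U n).2) hV⟩

theorem besovNorm_le_tsum (hp : 1 ≤ p) {S : 𝓓'(Ω, 𝕜)}
    (hS : ∀ φ, HasSum (fun n => T n φ) (S φ)) : besovNorm s p S ≤ ∑' n, besovNorm s p (T n) := by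
  simp only [besovNorm, iInf_subtype']
  refine le_trans (le_iInf fun U => ?_) (iInf_tsum_le_tsum_iInf _)
  by_cases hfin : ∑' n, besovNormWhole s p (U n).1 = ⊤
  · exact hfin ▸ le_top
  obtain ⟨V, hV⟩ := exists_hasSum_of_tsum_besovNormWhole_ne_top hp hfin
  exact (iInf_le _ ⟨V, isRestriction_of_hasSum (fun n => (U n).2) hV hS⟩).trans
    (besovNormWhole_le_tsum hp hV)

theorem exists_tendsto_besovNorm_sub_sum (hp : 1 ≤ p) {T : ℕ → 𝓓'(Ω, 𝕜)}
    (hT : ∑' n, besovNorm s p (T n) ≠ ⊤) :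
    ∃ S : 𝓓'(Ω, 𝕜), besovNorm s p S ≠ ⊤ ∧
      Tendsto (fun m => besovNorm s p (S - ∑ n ∈ Finset.range m, T n)) atTop (𝓝 0) := by
  obtain ⟨S, hS⟩ := exists_hasSum_of_tsum_besovNorm_ne_top hp hT
  refine ⟨S, ne_top_of_le_ne_top hT (besovNorm_le_tsum hp hS), ?_⟩
  have hasSum_tail (m : ℕ) (φ : 𝓓(Ω, ℝ)) :
      HasSum (fun n => T (n + m) φ) ((S - ∑ n ∈ Finset.range m, T n) φ) := by
    have sub_apply : (S - ∑ n ∈ Finset.range m, T n) φ =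
        S φ - ∑ n ∈ Finset.range m, T n φ := by
      simp
    rw [sub_apply]
    exact (hasSum_nat_add_iff' m).2 (hS φ)
  exact tendsto_of_tendsto_of_tendsto_of_le_of_le tendsto_const_nhds
    (ENNReal.tendsto_sum_nat_add _ hT) (fun _ => zero_le)
    fun m => besovNorm_le_tsum hp (hasSum_tail m)

end SeriesDomain

/-! ### The Besov space with the wavelet norm -/

section SequenceSpace

variable {Λ : Type*} {E : Λ → Type*} [∀ l, NormedAddCommGroup (E l)] {p : ℝ}

theorem tsum_enorm_rpow_ne_top_iff (hp : 0 ≤ p) {f : ∀ l, E l} :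
    ∑' l, ‖f l‖ₑ ^ p ≠ ⊤ ↔ Summable fun l => ‖f l‖ ^ p := by
  have enorm_rpow (l : Λ) : ‖‖f l‖ ^ p‖ₑ = ‖f l‖ₑ ^ p := by
    rw [Real.enorm_of_nonneg (by positivity),
      ← ENNReal.ofReal_rpow_of_nonneg (norm_nonneg _) hp, ofReal_norm]
  have norm_rpow (l : Λ) : ‖‖f l‖ ^ p‖ = ‖f l‖ ^ p := Real.norm_of_nonneg (by positivity)
  simpa only [enorm_rpow, norm_rpow] using
    tsum_enorm_ne_top_iff_summable_norm (f := fun l => ‖f l‖ ^ p)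

theorem memℓp_of_tsum_enorm_rpow_ne_top (hp : 0 < p) {f : ∀ l, E l}
    (hf : ∑' l, ‖f l‖ₑ ^ p ≠ ⊤) : Memℓp f (ENNReal.ofReal p) := by
  refine memℓp_gen ?_
  rwa [ENNReal.toReal_ofReal hp.le, ← tsum_enorm_rpow_ne_top_iff hp.le]

theorem enorm_lp_eq [Fact (1 ≤ ENNReal.ofReal p)] (hp : 0 < p) (f : lp E (ENNReal.ofReal p)) :
    ‖f‖ₑ = (∑' l, ‖f l‖ₑ ^ p) ^ (1 / p) := by
  have hp_toReal : (ENNReal.ofReal p).toReal = p := ENNReal.toReal_ofReal hp.le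
  have hsum : Summable fun l => ‖f l‖ ^ p := by
    simpa only [hp_toReal] using (lp.memℓp f).summable (hp_toReal.symm ▸ hp)
  rw [← ofReal_norm, lp.norm_eq_tsum_rpow (hp_toReal.symm ▸ hp), hp_toReal,
    ← ENNReal.ofReal_rpow_of_nonneg (by positivity) (by positivity),
    ENNReal.ofReal_tsum_of_nonneg (fun _ => by positivity) hsum]
  simp only [← ENNReal.ofReal_rpow_of_nonneg (norm_nonneg _) hp.le, ofReal_norm]

end SequenceSpace

namespace BesovWaveletBasis

variable {𝕜 : Type*} [RCLike 𝕜] {d : ℕ} {Ω : Opens (Space d)} {s p : ℝ} {hp : 1 ≤ p} {Λ : Type*}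
  (W : BesovWaveletBasis 𝕜 Ω s p hp Λ)

/-- The weighted wavelet coefficient `2^{(s + d (1/2 - 1/p)) |λ|} u_λ`; the wavelet norm is the
`ℓᵖ` norm of the family of these. -/
def weightedCoeff (l : Λ) : besovSpace 𝕜 Ω s p hp →ₗ[𝕜] 𝕜 :=
  (2 : ℝ) ^ ((s + d * (1 / 2 - 1 / p)) * (W.scale l : ℝ)) • W.coeff l

theorem enorm_weightedCoeff_rpow (u : besovSpace 𝕜 Ω s p hp) (l : Λ) :
    ‖W.weightedCoeff l u‖ₑ ^ p = ENNReal.ofReal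
      ((2 : ℝ) ^ (p * (s + d * (1 / 2 - 1 / p)) * (W.scale l : ℝ))) * ‖W.coeff l u‖ₑ ^ p := by
  have hp_nonneg : 0 ≤ p := zero_le_one.trans hp
  rw [weightedCoeff, LinearMap.smul_apply, enorm_smul, ENNReal.mul_rpow_of_nonneg _ _ hp_nonneg,
    Real.enorm_of_nonneg (by positivity), ENNReal.ofReal_rpow_of_nonneg (by positivity) hp_nonneg,
    ← Real.rpow_mul zero_le_two, mul_comm _ p, mul_assoc p]

theorem norm_coe (u : besovSpace 𝕜 Ω s p hp) :
    W.norm (u : 𝓓'(Ω, 𝕜)) = (∑' l, ‖W.weightedCoeff l u‖ₑ ^ p) ^ (1 / p) := by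
  simp only [enorm_weightedCoeff_rpow]
  exact dif_pos u.2

theorem mem_besovSpace_of_norm_lt_top {T : 𝓓'(Ω, 𝕜)} (hT : W.norm T < ⊤) :
    T ∈ besovSpace 𝕜 Ω s p hp := by
  by_contra h
  exact hT.ne (dif_neg h)

theorem exists_besovNorm_le : ∃ C : ℝ≥0, ∀ u : besovSpace 𝕜 Ω s p hp,
    besovNorm s p (u : 𝓓'(Ω, 𝕜)) ≤ C * W.norm (u : 𝓓'(Ω, 𝕜)) := by
  have hp_pos : 0 < p := zero_lt_one.trans_le hp
  obtain ⟨c, _, hc, _, h⟩ := W.norm_equiv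
  refine ⟨c⁻¹ ^ (1 / p), fun u => ?_⟩
  have hle : besovNorm s p (u : 𝓓'(Ω, 𝕜)) ^ p ≤
      (c⁻¹ : ℝ≥0) * ∑' l, ‖W.weightedCoeff l u‖ₑ ^ p := by
    simp only [enorm_weightedCoeff_rpow]
    rw [ENNReal.coe_inv hc.ne', mul_comm, ← div_eq_mul_inv, ENNReal.le_div_iff_mul_le
      (.inl (ENNReal.coe_ne_zero.2 hc.ne')) (.inl ENNReal.coe_ne_top), mul_comm]
    exact (h u).1
  rw [norm_coe, ENNReal.coe_rpow_of_nonneg _ (by positivity),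
    ← ENNReal.mul_rpow_of_nonneg _ _ (by positivity), one_div, ENNReal.le_rpow_inv_iff hp_pos]
  exact hle

theorem exists_norm_le_besovNorm : ∃ C : ℝ≥0, ∀ u : besovSpace 𝕜 Ω s p hp,
    W.norm (u : 𝓓'(Ω, 𝕜)) ≤ C * besovNorm s p (u : 𝓓'(Ω, 𝕜)) := by
  have hp_pos : 0 < p := zero_lt_one.trans_le hp
  obtain ⟨_, C, _, _, h⟩ := W.norm_equiv
  refine ⟨C ^ (1 / p), fun u => ?_⟩
  rw [norm_coe, ENNReal.coe_rpow_of_nonneg _ (by positivity), one_div,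
    ENNReal.rpow_inv_le_iff hp_pos, ENNReal.mul_rpow_of_nonneg _ _ hp_pos.le,
    ENNReal.rpow_inv_rpow hp_pos.ne']
  simp only [enorm_weightedCoeff_rpow]
  exact (h u).2

theorem norm_coe_lt_top (u : besovSpace 𝕜 Ω s p hp) : W.norm (u : 𝓓'(Ω, 𝕜)) < ⊤ := by
  obtain ⟨C, hC⟩ := W.exists_norm_le_besovNorm
  exact (hC u).trans_lt (ENNReal.mul_lt_top ENNReal.coe_lt_top u.2)

theorem memℓp_weightedCoeff (u : besovSpace 𝕜 Ω s p hp) :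
    Memℓp (fun l => W.weightedCoeff l u) (ENNReal.ofReal p) := by
  have hp_pos : 0 < p := zero_lt_one.trans_le hp
  refine memℓp_of_tsum_enorm_rpow_ne_top hp_pos fun htop => (W.norm_coe_lt_top u).ne ?_
  rw [norm_coe, htop, ENNReal.top_rpow_of_pos (by positivity)]

/-- The Besov space `B^s_p(Ω)` equipped with the wavelet norm of `W` (a copy of the submodule
`besovSpace`, on which the norm depends on `W`). -/
def WaveletSpace (_ : BesovWaveletBasis 𝕜 Ω s p hp Λ) : Type _ := besovSpace 𝕜 Ω s p hp

namespace WaveletSpace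

instance : AddCommGroup W.WaveletSpace := inferInstanceAs (AddCommGroup (besovSpace 𝕜 Ω s p hp))

instance : Module 𝕜 W.WaveletSpace := inferInstanceAs (Module 𝕜 (besovSpace 𝕜 Ω s p hp))

/-- The identity, forgetting the wavelet norm. -/
def toBesov : W.WaveletSpace →ₗ[𝕜] besovSpace 𝕜 Ω s p hp := LinearMap.id

/-- The family of weighted wavelet coefficients as a map to `ℓᵖ`, which induces the norm. -/
def toLp : W.WaveletSpace →ₗ[𝕜] lp (fun _ : Λ => 𝕜) (ENNReal.ofReal p) where
  toFun u := ⟨fun l => W.weightedCoeff l (toBesov W u), W.memℓp_weightedCoeff _⟩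
  map_add' u v := by
    ext l
    exact map_add (W.weightedCoeff l) _ _
  map_smul' c u := by
    ext l
    exact map_smul (W.weightedCoeff l) _ _

variable [Fact (1 ≤ ENNReal.ofReal p)]

theorem enorm_toLp (u : W.WaveletSpace) :
    ‖toLp W u‖ₑ = W.norm (toBesov W u : 𝓓'(Ω, 𝕜)) := by
  rw [norm_coe, enorm_lp_eq (zero_lt_one.trans_le hp)]
  rfl

theorem toLp_injective : Function.Injective (toLp W) := by
  refine (injective_iff_map_eq_zero _).2 fun u hu => ?_
  obtain ⟨C, hC⟩ := W.exists_besovNorm_le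
  have hle := hC (toBesov W u)
  rw [← enorm_toLp, hu, enorm_zero, mul_zero, nonpos_iff_eq_zero] at hle
  exact Subtype.ext (eq_zero_of_besovNorm_eq_zero hp hle)

instance : NormedAddCommGroup W.WaveletSpace :=
  NormedAddCommGroup.induced _ _ (toLp W) (toLp_injective W)

instance : NormedSpace 𝕜 W.WaveletSpace := NormedSpace.induced 𝕜 _ _ (toLp W)

instance : NormedSpace ℝ W.WaveletSpace := NormedSpace.restrictScalars ℝ 𝕜 _

theorem enorm_eq (u : W.WaveletSpace) : ‖u‖ₑ = W.norm (toBesov W u : 𝓓'(Ω, 𝕜)) :=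
  enorm_toLp W u

theorem uniformConvexSpace (hp_one : 1 < p) : UniformConvexSpace W.WaveletSpace :=
  have := uniformConvexSpace_lp Λ 𝕜 (ENNReal.one_lt_ofReal.2 hp_one) ENNReal.ofReal_ne_top
  uniformConvexSpace_of_norm_map_eq (toLp W) fun _ => rfl

instance : CompleteSpace W.WaveletSpace := by
  refine NormedAddCommGroup.completeSpace_of_summable_imp_tendsto fun u hu => ?_
  obtain ⟨C₁, hC₁⟩ := W.exists_besovNorm_le
  obtain ⟨C₂, hC₂⟩ := W.exists_norm_le_besovNorm
  have tsum_ne_top : ∑' n, besovNorm s p (toBesov W (u n) : 𝓓'(Ω, 𝕜)) ≠ ⊤ := by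
    refine ne_top_of_le_ne_top ?_ (ENNReal.tsum_le_tsum fun n => hC₁ (toBesov W (u n)))
    simp only [← enorm_eq]
    rw [ENNReal.tsum_mul_left]
    exact ENNReal.mul_ne_top ENNReal.coe_ne_top (tsum_enorm_ne_top_iff_summable_norm.2 hu)
  obtain ⟨S, hS, hlim⟩ := exists_tendsto_besovNorm_sub_sum hp tsum_ne_top
  let S' : W.WaveletSpace := (⟨S, hS.lt_top⟩ : besovSpace 𝕜 Ω s p hp)
  refine ⟨S', tendsto_iff_edist_tendsto_0.2 ?_⟩
  have hlim_mul := ENNReal.Tendsto.const_mul (a := (C₂ : ℝ≥0∞)) hlim (.inr ENNReal.coe_ne_top)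
  rw [mul_zero] at hlim_mul
  refine tendsto_of_tendsto_of_tendsto_of_le_of_le tendsto_const_nhds hlim_mul
    (fun _ => zero_le) fun m => ?_
  rw [edist_comm, edist_eq_enorm_sub, enorm_eq]
  refine (hC₂ _).trans_eq ?_
  rw [map_sub, map_sum, Submodule.coe_sub, Submodule.coe_sum]
  rfl

end WaveletSpace

end BesovWaveletBasis

/-! ### Tikhonov regularization in the wavelet norm -/

section Convergence

variable {𝕜 : Type*} [RCLike 𝕜] {d : ℕ} {Ω : Opens (Space d)}
  {sD pD sR pR : ℝ} {hpD : 1 ≤ pD} {hpR : 1 ≤ pR} {Λ : Type*}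
  {W : BesovWaveletBasis 𝕜 Ω sR pR hpR Λ} {F : besovSpace 𝕜 Ω sD pD hpD →ₗ[𝕜] L2 𝕜 Ω}

theorem BesovEmbeds.le (h : BesovEmbeds 𝕜 Ω sR pR sD pD) :
    besovSpace 𝕜 Ω sR pR hpR ≤ besovSpace 𝕜 Ω sD pD hpD := by
  obtain ⟨C, hC⟩ := h
  exact fun T hT => (hC T hT).trans_lt (ENNReal.mul_lt_top ENNReal.coe_lt_top hT)

variable (W hpD) in
/-- The inclusion of `B_R`, with its wavelet norm, into `B_D`. -/
def BesovEmbeds.inclusion (h : BesovEmbeds 𝕜 Ω sR pR sD pD) :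
    W.WaveletSpace →ₗ[𝕜] besovSpace 𝕜 Ω sD pD hpD :=
  Submodule.inclusion h.le ∘ₗ BesovWaveletBasis.WaveletSpace.toBesov W

theorem BesovEmbeds.exists_inclusion_eq (h : BesovEmbeds 𝕜 Ω sR pR sD pD)
    {u : besovSpace 𝕜 Ω sD pD hpD} (hu : W.norm (u : 𝓓'(Ω, 𝕜)) < ⊤) :
    ∃ x, h.inclusion hpD W x = u :=
  ⟨(⟨u, W.mem_besovSpace_of_norm_lt_top hu⟩ : besovSpace 𝕜 Ω sR pR hpR), rfl⟩

theorem norm_lt_top_of_tikhonov_lt_top {w : L2 𝕜 Ω} {α : ℝ} (hα : 0 < α)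
    {u : besovSpace 𝕜 Ω sD pD hpD} (hu : tikhonov W F w α u < ⊤) :
    W.norm (u : 𝓓'(Ω, 𝕜)) < ⊤ := by
  have hpR_pos : 0 < pR := zero_lt_one.trans_le hpR
  refine lt_top_iff_ne_top.2 fun htop => hu.ne ?_
  rw [tikhonov, htop, ENNReal.top_rpow_of_pos hpR_pos,
    ENNReal.mul_top (ENNReal.ofReal_pos.2 hα).ne', add_top]

variable [Fact (1 ≤ ENNReal.ofReal pR)]

theorem BesovEmbeds.norm_inclusion (h : BesovEmbeds 𝕜 Ω sR pR sD pD) (x : W.WaveletSpace) :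
    W.norm (h.inclusion hpD W x : 𝓓'(Ω, 𝕜)) = ‖x‖ₑ :=
  (BesovWaveletBasis.WaveletSpace.enorm_eq W x).symm

theorem exists_norm_map_inclusion_le (hF : IsBoundedOp F)
    (h : BesovEmbeds 𝕜 Ω sR pR sD pD) :
    ∃ C : ℝ, ∀ x, ‖F (h.inclusion hpD W x)‖ ≤ C * ‖x‖ := by
  obtain ⟨C₁, hC₁⟩ := hF
  obtain ⟨C₂, hC₂⟩ := id h
  obtain ⟨C₃, hC₃⟩ := W.exists_besovNorm_le
  refine ⟨(C₁ * (C₂ * C₃) : ℝ≥0), fun x => ?_⟩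
  have henorm : ‖F (h.inclusion hpD W x)‖ₑ ≤ (C₁ * (C₂ * C₃) : ℝ≥0) * ‖x‖ₑ := by
    set y := BesovWaveletBasis.WaveletSpace.toBesov W x
    calc ‖F (h.inclusion hpD W x)‖ₑ
        ≤ C₁ * besovNorm sD pD (y : 𝓓'(Ω, 𝕜)) := hC₁ _
      _ ≤ C₁ * (C₂ * besovNorm sR pR (y : 𝓓'(Ω, 𝕜))) := by gcongr; exact hC₂ y y.2
      _ ≤ C₁ * (C₂ * (C₃ * ‖x‖ₑ)) := by
        gcongr
        exact (hC₃ y).trans_eq (by rw [BesovWaveletBasis.WaveletSpace.enorm_eq])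
      _ = (C₁ * (C₂ * C₃) : ℝ≥0) * ‖x‖ₑ := by push_cast; ring
  simp only [enorm_eq_nnnorm] at henorm
  exact_mod_cast henorm

variable (W) in
/-- The forward operator `F` on `B_R` with its wavelet norm, as a bounded real-linear operator. -/
def IsBoundedOp.forwardOperator (hF : IsBoundedOp F) (h : BesovEmbeds 𝕜 Ω sR pR sD pD) :
    W.WaveletSpace →L[ℝ] L2 𝕜 Ω :=
  ((F ∘ₗ h.inclusion hpD W).mkContinuousOfExistsBound
    (exists_norm_map_inclusion_le hF h)).restrictScalars ℝ

theorem IsBoundedOp.forwardOperator_apply (hF : IsBoundedOp F)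
    (h : BesovEmbeds 𝕜 Ω sR pR sD pD) (x : W.WaveletSpace) :
    hF.forwardOperator W h x = F (h.inclusion hpD W x) :=
  rfl

theorem tikhonov_inclusion (h : BesovEmbeds 𝕜 Ω sR pR sD pD) (w : L2 𝕜 Ω) {α : ℝ} (hα : 0 ≤ α)
    (x : W.WaveletSpace) :
    tikhonov W F w α (h.inclusion hpD W x) = ENNReal.ofReal
      (‖F (h.inclusion hpD W x) - w‖ ^ 2 + α * ‖x‖ ^ pR) := by
  have hpR_nonneg : 0 ≤ pR := zero_le_one.trans hpR
  rw [tikhonov, h.norm_inclusion, ENNReal.ofReal_add (by positivity)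
    (by positivity), ENNReal.ofReal_mul hα,
    ← ENNReal.ofReal_rpow_of_nonneg (norm_nonneg _) hpR_nonneg,
    ENNReal.ofReal_pow (norm_nonneg _), ofReal_norm, ofReal_norm]

theorem tikhonov_inclusion_le_iff (h : BesovEmbeds 𝕜 Ω sR pR sD pD) {w : L2 𝕜 Ω} {α : ℝ}
    (hα : 0 ≤ α) {x y : W.WaveletSpace} :
    tikhonov W F w α (h.inclusion hpD W x) ≤ tikhonov W F w α (h.inclusion hpD W y) ↔
      ‖F (h.inclusion hpD W x) - w‖ ^ 2 + α * ‖x‖ ^ pR ≤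
        ‖F (h.inclusion hpD W y) - w‖ ^ 2 + α * ‖y‖ ^ pR := by
  rw [tikhonov_inclusion h w hα, tikhonov_inclusion h w hα,
    ENNReal.ofReal_le_ofReal_iff (by positivity)]

theorem exists_inclusion_eq_of_tikhonov_le (h : BesovEmbeds 𝕜 Ω sR pR sD pD) {w : L2 𝕜 Ω} {α : ℝ}
    (hα : 0 < α) {u : besovSpace 𝕜 Ω sD pD hpD} {x₀ : W.WaveletSpace}
    (hu : tikhonov W F w α u ≤ tikhonov W F w α (h.inclusion hpD W x₀)) :
    ∃ x, h.inclusion hpD W x = u ∧ ‖F (h.inclusion hpD W x) - w‖ ^ 2 + α * ‖x‖ ^ pR ≤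
      ‖F (h.inclusion hpD W x₀) - w‖ ^ 2 + α * ‖x₀‖ ^ pR := by
  have hlt_top : tikhonov W F w α u < ⊤ := by
    rw [tikhonov_inclusion h w hα.le] at hu
    exact hu.trans_lt ENNReal.ofReal_lt_top
  obtain ⟨x, rfl⟩ := h.exists_inclusion_eq (norm_lt_top_of_tikhonov_lt_top hα hlt_top)
  exact ⟨x, rfl, (tikhonov_inclusion_le_iff h hα.le).1 hu⟩

theorem IsMinNormSolution.norm_le {v : L2 𝕜 Ω} (h : BesovEmbeds 𝕜 Ω sR pR sD pD)
    {x₀ : W.WaveletSpace} (hx₀ : IsMinNormSolution W F v (h.inclusion hpD W x₀))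
    {x : W.WaveletSpace} (hx : F (h.inclusion hpD W x) = v) : ‖x₀‖ ≤ ‖x‖ := by
  have hle := hx₀.2.2 _ hx
  rwa [h.norm_inclusion, h.norm_inclusion, enorm_le_iff_norm_le] at hle

end Convergence

end BesovTikhonov

end

theorem mainTheorem1_general {𝕜 : Type*} [RCLike 𝕜] {d : ℕ} {Ω : Opens (Space d)}
    {sD sR pD pR : ℝ} {hpD : 1 ≤ pD} (hpR : 1 < pR) (hRD : BesovEmbeds 𝕜 Ω sR pR sD pD)
    {Λ : Type*} {W : BesovWaveletBasis 𝕜 Ω sR pR hpR.le Λ}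
    {F : besovSpace 𝕜 Ω sD pD hpD →ₗ[𝕜] L2 𝕜 Ω} (hF : IsBoundedOp F)
    {v : L2 𝕜 Ω} {udag : besovSpace 𝕜 Ω sD pD hpD} (hudag : IsMinNormSolution W F v udag)
    {ι : Type*} {l : Filter ι} {α : ι → ℝ} {vδ : ι → L2 𝕜 Ω} {u : ι → besovSpace 𝕜 Ω sD pD hpD}
    (hα : Tendsto α l (𝓝[>] 0)) (hvδ : Tendsto (fun i => ‖v - vδ i‖ ^ 2 / α i) l (𝓝 0))
    (hu : ∀ᶠ i in l, tikhonov W F (vδ i) (α i) (u i) ≤ tikhonov W F (vδ i) (α i) udag) :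
    Tendsto (fun i => W.norm ((u i - udag : besovSpace 𝕜 Ω sD pD hpD) : 𝓓'(Ω, 𝕜))) l (𝓝 0) := by
  have : Fact (1 ≤ ENNReal.ofReal pR) := ⟨ENNReal.one_le_ofReal.2 hpR.le⟩
  have := BesovWaveletBasis.WaveletSpace.uniformConvexSpace W hpR
  obtain ⟨u₀, rfl⟩ := hRD.exists_inclusion_eq hudag.2.1
  obtain rfl | hl := l.eq_or_neBot
  · exact tendsto_bot
  have lift : ∀ᶠ i in l, ∃ x, hRD.inclusion hpD W x = u i ∧
      ‖F (hRD.inclusion hpD W x) - vδ i‖ ^ 2 + α i * ‖x‖ ^ pR ≤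
        ‖F (hRD.inclusion hpD W u₀) - vδ i‖ ^ 2 + α i * ‖u₀‖ ^ pR := by
    filter_upwards [hu, hα.eventually self_mem_nhdsWithin] with i hui hαi
    exact exists_inclusion_eq_of_tikhonov_le hRD hαi hui
  obtain ⟨x, hx⟩ := lift.choice
  have hlim : Tendsto x l (𝓝 u₀) := by
    refine tendsto_of_tikhonov_le (hF.forwardOperator W hRD) (fun w hw => ?_)
      (zero_lt_one.trans hpR) hα ?_ (hx.mono fun i hi => hi.2)
    · exact hudag.norm_le hRD (hw.trans hudag.1)
    · simpa only [IsBoundedOp.forwardOperator_apply, hudag.1] using hvδ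
  rw [tendsto_iff_edist_tendsto_0] at hlim
  refine hlim.congr' (hx.mono fun i hi => ?_)
  beta_reduce
  rw [← hi.1, ← map_sub, hRD.norm_inclusion, edist_eq_enorm_sub]

theorem mainTheorem1 {𝕜 : Type*} [RCLike 𝕜] {d : ℕ} (Ω : Opens (Space d))
    (sD sR pD pR : ℝ) (hpD : 1 < pD) (hpR : 1 < pR)
    (hRD : BesovEmbeds 𝕜 Ω sR pR sD pD)
    {Λ : Type*} (W : BesovWaveletBasis 𝕜 Ω sR pR hpR.le Λ)
    (F : besovSpace 𝕜 Ω sD pD hpD.le →ₗ[𝕜] L2 𝕜 Ω) (hF : IsBoundedOp F)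
    (v : L2 𝕜 Ω) (udag : besovSpace 𝕜 Ω sD pD hpD.le) (hudag : IsMinNormSolution W F v udag)
    {ι : Type*} (l : Filter ι) (δ α : ι → ℝ) (vδ : ι → L2 𝕜 Ω)
    (u : ι → besovSpace 𝕜 Ω sD pD hpD.le)
    (hδ : Tendsto δ l (𝓝[>] 0))
    (hvδ : ∀ᶠ i in l, ‖v - vδ i‖ ≤ δ i)
    (hα : ∃ c C : ℝ, 0 < c ∧ 0 < C ∧ ∀ᶠ i in l, c * δ i ≤ α i ∧ α i ≤ C * δ i)
    (hu : ∀ᶠ i in l, ∀ w : besovSpace 𝕜 Ω sD pD hpD.le,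
      tikhonov W F (vδ i) (α i) (u i) ≤ tikhonov W F (vδ i) (α i) w) :
    Tendsto (fun i => W.norm ((u i - udag : besovSpace 𝕜 Ω sD pD hpD.le) : 𝓓'(Ω, 𝕜))) l (𝓝 0) := by
  obtain ⟨c, C, hc, -, hα⟩ := hα
  exact mainTheorem1_general hpR hRD hF hudag (tendsto_nhdsGT_zero_of_le_of_le hc hδ hα)
    (tendsto_sq_div_zero_of_le hc hδ (by simpa only [abs_norm] using hvδ)
      (hα.mono fun _ hαi => hαi.1)) (hu.mono fun _ hui => hui udag)
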